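/- Let $\mathbb N=\{0,1,2,\dots\}$ and let $m,n\ge 1$ be integers. For $\xi=(u_1,\dots,u_m)\in\mathbb N^m$ put $\deg\xi=u_1+\cdots+u_m$, and for $\alpha=(\xi,i)\in\mathbb N^m\times\{1,\dots,n\}$ put $\deg\alpha=\deg\xi$. Order $\mathbb N^m\times\{1,\dots,n\}$ by $(\xi,i)\le(\tau,j)$ if and only if $i=j$ and $\xi\le\tau$ coordinatewise. An antichain sequence is a finite sequence $\bar\alpha=(\alpha_1,\dots,\alpha_k)$ of elements of $\mathbb N^m\times\{1,\dots,n\}$ such that $\alpha_i$ and $\alpha_j$ are incomparable whenever $i\ne j$. For an increasing (i.e. nondecreasing) function $f:\mathbb N_{>0}\to\mathbb N$, let $\mathfrak L_{f,m}^n$ be the maximal length of an antichain sequence with $\deg\alpha_i\le f(i)$ for all $i$. For $\eta,\tau\in\mathbb N^m$ let $\operatorname{LUB}(\eta,\tau)$ be their coordinatewise maximum, and let $\mathbf k\in\mathbb N^m$ denote the $k$-th unit vector. For a set $S\subseteq\mathbb N^m\times\{1,\dots,n\}$ let $\gamma(S)=\{(\operatorname{LUB}(\eta,\zeta),l):\eta\ne\zeta,\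 (\eta,l),(\zeta,l)\in S\}$. Given an antichain sequence $\bar\alpha$ and $p\in\mathbb N$, let $\Gamma_{\bar\alpha}(p)$ be the set of the members of $\bar\alpha$ of degree at most $p$. For $r\in\mathbb N$ let $D_{r,\bar\alpha}$ be the smallest integer $p\ge r$ with the following property: for every $(\tau,l)\in\gamma(\Gamma_{\bar\alpha}(p))$ with $\deg\tau>p$ and all $1\le i<j\le m$ such that $(\tau-\mathbf i,l)\ge\beta_1$ and $(\tau-\mathbf j,l)\ge\beta_2$ for some $\beta_1,\beta_2\in\Gamma_{\bar\alpha}(p)$, there are a sequence $(\eta_1,l),\dots,(\eta_s,l)$ in $\Gamma_{\bar\alpha}(p)$ and indices $k_1,\dots,k_s\in\{1,\dots,m\}$ with $k_1=i$, $k_s=j$, such that $\eta_\ell\le\tau-\mathbf k_\ell$ for $\ell=1,\dots,s$ and $\deg\operatorname{LUB}(\eta_\ell,\eta_{\ell+1})\le p$ for $\ell=1,\dots,s-1$. (Here $\tau-\mathbf k$ may have a negative entry, in which case it lies above no element of $\mathbb N^m$.) Let $$C_{r,m}^n=\max\{D_{r,\bar\alpha}:\bar\alpha\text{ is an antichain sequence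 of }\mathbb N^m\times\{1,\dots,n\}\}.$$ Let $A$ be the Ackermann function: $A(0,y)=y+1$, $A(x,0)=A(x-1,1)$ for $x>0$, and $A(x,y)=A(x-1,A(x,y-1))$ for $x,y>0$. **Theorem.** Let $m\ge1$ and $r\ge0$ be integers, and let $g(1)=r$ and $g(i)=i+r-2$ for $i\ge2$. Then the maxima defining $\mathfrak L_{g,m}^1$ and $C_{r,m}^1$ exist (are finite), and $$C_{r,m}^1=\mathfrak L_{g,m}^1+r-1.$$ Moreover, if $r\ge1$, then $$C_{r,m}^1=A(m-1,\,C_{r-1,m}^1)\qquad\text{and}\qquad C_{r,m}^1\le A(m,r-1)-1,$$ and if $r\ge2$, then $$A(m,r-2)\le C_{r,m}^1.$$ -/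

import Mathlib

namespace DiffKernel

/-- The set `ℕ^m × {1, …, n}`. The order used on it is `Idx.le` below. -/
structure Idx (m n : ℕ) where
  exp : Fin m → ℕ
  comp : Fin n

/-- The degree of an element of `ℕ^m`. -/
def deg {m : ℕ} (ξ : Fin m → ℕ) : ℕ := ∑ t, ξ t

/-- `(ξ, i) ≤ (τ, j)` iff `i = j` and `ξ ≤ τ` in the product order of `ℕ^m`. -/
def Idx.le {m n : ℕ} (α β : Idx m n) : Prop := α.comp = β.comp ∧ α.exp ≤ β.exp

/-- A finite sequence of pairwise incomparable elements. -/
def IsAntichainSeq {m n k : ℕ} (α : Fin k → Idx m n) : Prop :=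
  ∀ i j, i ≠ j → ¬ (α i).le (α j)

/-- `f` bounds the degree growth of `α_1, …, α_k`. The sequence is indexed from `0` in Lean, so its
`i`-th entry is compared with `f (i + 1)`; the value `f 0` is never used. -/
def BoundsDegreeGrowth {m n k : ℕ} (f : ℕ → ℕ) (α : Fin k → Idx m n) : Prop :=
  ∀ i : Fin k, deg (α i).exp ≤ f (i + 1)

/-- The lengths of the antichain sequences of degree growth bounded by `f`. -/
def antichainLengths (f : ℕ → ℕ) (m n : ℕ) : Set ℕ :=
  {k | ∃ α : Fin k → Idx m n, IsAntichainSeq α ∧ BoundsDegreeGrowth f α}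

/-- `𝔏_{f,m}^n`, the maximal length of an antichain sequence of degree growth bounded by `f`. -/
noncomputable def maxLength (f : ℕ → ℕ) (m n : ℕ) : ℕ := sSup (antichainLengths f m n)

/-- `Γ_α(p)`: the members of the sequence of degree at most `p`. -/
def gammaUpTo {m n k : ℕ} (α : Fin k → Idx m n) (p : ℕ) : Set (Idx m n) :=
  {β | β ∈ Set.range α ∧ deg β.exp ≤ p}

/-- `γ(S)`: the least upper bounds of two distinct elements of `S` with the same component. -/
def lubSet {m n : ℕ} (S : Set (Idx m n)) : Set (Idx m n) :=
  {τ | ∃ η ζ : Fin m → ℕ, η ≠ ζ ∧ Idx.mk η τ.comp ∈ S ∧ Idx.mk ζ τ.comp ∈ S ∧ τ.exp = η ⊔ ζ}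

/-- `η ≤ τ - 𝐢`, where `𝐢` is the `i`-th unit vector. It is written as `η + 𝐢 ≤ τ`,
so that it fails when the `i`-th entry of `τ` is `0`. -/
def LeSubUnit {m : ℕ} (η τ : Fin m → ℕ) (i : Fin m) : Prop := η + Pi.single i 1 ≤ τ

/-- The condition on `p` in the definition of `D_{r,α}`. For `τ` in `γ(Γ_α(p))` of degree
greater than `p` and `i < j` such that `τ - 𝐢` and `τ - 𝐣` both lie above members of `Γ_α(p)`, there
are members `η_0, …, η_s` of `Γ_α(p)` in the component of `τ` and indices `k_0 = i, …, k_s = j` with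
`η_l ≤ τ - 𝐤_l` for all `l`, and `deg LUB(η_l, η_{l+1}) ≤ p` for all `l < s`. -/
def ChainCondition {m n k : ℕ} (α : Fin k → Idx m n) (p : ℕ) : Prop :=
  ∀ τ ∈ lubSet (gammaUpTo α p), p < deg τ.exp →
    ∀ i j : Fin m, i < j →
      (∃ β ∈ gammaUpTo α p, β.comp = τ.comp ∧ LeSubUnit β.exp τ.exp i) →
      (∃ β ∈ gammaUpTo α p, β.comp = τ.comp ∧ LeSubUnit β.exp τ.exp j) →
      ∃ (s : ℕ) (η : Fin (s + 1) → Fin m → ℕ) (κ : Fin (s + 1) → Fin m),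
        (∀ l, Idx.mk (η l) τ.comp ∈ gammaUpTo α p) ∧
        (∀ l, LeSubUnit (η l) τ.exp (κ l)) ∧
        κ 0 = i ∧ κ (Fin.last s) = j ∧
        ∀ l : Fin s, deg (η l.castSucc ⊔ η l.succ) ≤ p

/-- `D_{r,α}`: the smallest `p ≥ r` satisfying the condition. -/
noncomputable def D {m n k : ℕ} (r : ℕ) (α : Fin k → Idx m n) : ℕ :=
  sInf {p | r ≤ p ∧ ChainCondition α p}

/-- The set in the definition of `D` is never empty, so `D` is really its least element. -/
theorem D_isLeast {m n k : ℕ} (r : ℕ) (α : Fin k → Idx m n) :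
    IsLeast {p | r ≤ p ∧ ChainCondition α p} (D r α) := by
  have hne : ({p | r ≤ p ∧ ChainCondition α p} : Set ℕ).Nonempty := by
    refine ⟨r + 2 * ∑ i, deg (α i).exp, by omega, ?_⟩
    rintro τ ⟨η, ζ, -, ⟨⟨a, ha⟩, -⟩, ⟨⟨b, hb⟩, -⟩, hτ⟩ hlt
    exfalso
    have h1 : deg η ≤ ∑ i, deg (α i).exp := by
      have := Finset.single_le_sum (f := fun i => deg (α i).exp) (fun _ _ => Nat.zero_le _)
        (Finset.mem_univ a)
      simpa [ha] using this
    have h2 : deg ζ ≤ ∑ i, deg (α i).exp := by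
      have := Finset.single_le_sum (f := fun i => deg (α i).exp) (fun _ _ => Nat.zero_le _)
        (Finset.mem_univ b)
      simpa [hb] using this
    have h3 : deg τ.exp ≤ deg η + deg ζ := by
      rw [hτ]
      unfold deg
      rw [← Finset.sum_add_distrib]
      refine Finset.sum_le_sum fun t _ => ?_
      simp only [Pi.sup_apply]
      omega
    omega
  exact ⟨Nat.sInf_mem hne, fun _ hp => Nat.sInf_le hp⟩

/-- The values `D_{r,α}` for all antichain sequences `α` of `ℕ^m × {1, …, n}`. -/
def DValues (r m n : ℕ) : Set ℕ :=
  {d | ∃ (k : ℕ) (α : Fin k → Idx m n), IsAntichainSeq α ∧ d = D r α}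

/-- `C_{r,m}^n`, the maximum of the numbers `D_{r,α}`. -/
noncomputable def C (r m n : ℕ) : ℕ := sSup (DValues r m n)

/-- `g(1) = r` and `g(i) = i + r - 2` for `i ≥ 2`; the value at `0` is never used. -/
def g (r : ℕ) (i : ℕ) : ℕ := if i = 1 then r else i + r - 2

end DiffKernel

namespace DiffKernel

/-! ### Degrees -/

/-! Write `F = (ack (m - 1))^[r] 0`. The proof shows that `C` equals `F` and that the maximal length
is `F + 1 - r`; the remaining relations follow from the recursion and the monotonicity of `ack`. If
`m = 1` or `r = 0`, vectors of degree at most `r` are pairwise comparable and both values are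
trivial. Let `m ≥ 2` and `r ≥ 1`, and read vectors as monomials.

Upper bounds. Count the multiples of degree `e` of an antichain. By Macaulay's theorem
(`macaulay_of_two_le`) the upper shadow of a set is at least as large as that of a lexicographic
segment of the same size. The extremal antichain consists of `x_0^r` and one monomial in each degree
`r, …, F - 1`; its multiples form segments and exhaust degree `F - 1`. A family that starts as large
and always exceeds Macaulay's minimum by as much must stop before degree `F` (`lt_of_growth`). For
the length, the excess consists of the new members. For `D`, a failure of the chain condition in
degree `d + 1` must force an excess from `d` to `d + 1`. This is the contrapositive of a
Gotzmann-type theorem: minimal growth persists, and multiples of degree `d` below a common `τ` are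
joined by steps whose least upper bounds have degree at most `d + 1` (`persistence`, `Gotz.joined`).
It is proved by induction on the number of variables, with slices and compressions.

Lower bounds. In the extremal antichain the member of degree `p` obstructs the chain condition for
`p` (`le_D_extremalSeq`). The iterate in `F` arises because lowering the exponent of `x_0` by one
costs a complete run in one variable fewer, which applies `ack (m - 1)` once (`LexStage.iterate`).
-/

theorem deg_add {m : ℕ} (u v : Fin m → ℕ) : deg (u + v) = deg u + deg v := by
  simp [deg, Finset.sum_add_distrib]

@[simp] theorem deg_single {m : ℕ} (i : Fin m) (a : ℕ) : deg (Pi.single i a) = a := by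
  simp [deg]

theorem deg_add_single {m : ℕ} (u : Fin m → ℕ) (i : Fin m) :
    deg (u + Pi.single i 1) = deg u + 1 := by
  rw [deg_add, deg_single]

theorem deg_mono {m : ℕ} {u v : Fin m → ℕ} (h : u ≤ v) : deg u ≤ deg v :=
  Finset.sum_le_sum fun i _ => h i

theorem eq_of_le_of_deg_le {m : ℕ} {u v : Fin m → ℕ} (h : u ≤ v) (hd : deg v ≤ deg u) :
    u = v := by
  funext i
  by_contra hne
  have : deg u < deg v :=
    Finset.sum_lt_sum (fun i _ => h i) ⟨i, Finset.mem_univ _, lt_of_le_of_ne (h i) hne⟩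
  omega

theorem exists_lt_of_deg_lt {m : ℕ} {u v : Fin m → ℕ} (h : deg u < deg v) :
    ∃ i, u i < v i := by
  by_contra hc
  push Not at hc
  exact absurd (deg_mono hc) (by omega)

/-- Distinct vectors of the same degree: some entry of the first is smaller. -/
theorem exists_lt_of_ne {m : ℕ} {u v : Fin m → ℕ} (hd : deg u = deg v) (h : u ≠ v) :
    ∃ i, u i < v i := by
  by_contra hc
  push Not at hc
  exact h (eq_of_le_of_deg_le hc hd.le).symm

theorem add_single_le {m : ℕ} {u v : Fin m → ℕ} (h : u ≤ v) {i : Fin m} (hi : u i < v i) :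
    u + Pi.single i 1 ≤ v := by
  intro k
  by_cases hk : k = i
  · subst hk; simpa using hi
  · simpa [Pi.single_eq_of_ne hk] using h k

theorem exists_between {m : ℕ} {u v : Fin m → ℕ} (h : u ≤ v) {e : ℕ} (h1 : deg u ≤ e)
    (h2 : e ≤ deg v) : ∃ w, u ≤ w ∧ w ≤ v ∧ deg w = e := by
  induction e, h1 using Nat.le_induction with
  | base => exact ⟨u, le_rfl, h, rfl⟩
  | succ e _ ih =>
    obtain ⟨w, hw1, hw2, hw3⟩ := ih (by omega)
    obtain ⟨i, hi⟩ := exists_lt_of_deg_lt (u := w) (v := v) (by omega)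
    exact ⟨w + Pi.single i 1, hw1.trans (by simp), add_single_le hw2 hi,
      by rw [deg_add_single, hw3]⟩

/-- Every vector with a positive entry is a successor. -/
theorem exists_eq_add_single {m : ℕ} {u : Fin m → ℕ} {i : Fin m} (h : 0 < u i) :
    ∃ w : Fin m → ℕ, u = w + Pi.single i 1 := by
  refine ⟨u - Pi.single i 1, ?_⟩
  funext k
  by_cases hk : k = i
  · subst hk; simp; omega
  · simp [Pi.single_eq_of_ne hk]

theorem deg_insertNth {m : ℕ} (i : Fin (m + 1)) (j : ℕ) (v : Fin m → ℕ) :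
    deg (i.insertNth j v : Fin (m + 1) → ℕ) = j + deg v := by
  simp [deg, Fin.sum_univ_succAbove _ i]

theorem deg_eq_add_removeNth {m : ℕ} (i : Fin (m + 1)) (u : Fin (m + 1) → ℕ) :
    deg u = u i + deg (i.removeNth u) := by
  simp [deg, Fin.sum_univ_succAbove _ i, Fin.removeNth]

/-! ### Unit vectors and insertion of an entry -/

theorem insertNth_add_single_self {m : ℕ} (i : Fin (m + 1)) (j : ℕ) (v : Fin m → ℕ) :
    (i.insertNth j v : Fin (m + 1) → ℕ) + Pi.single i 1 = i.insertNth (j + 1) v := by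
  funext k
  rcases Fin.eq_self_or_eq_succAbove i k with rfl | ⟨l, rfl⟩
  · simp
  · simp

theorem insertNth_add_single_succAbove {m : ℕ} (i : Fin (m + 1)) (j : ℕ) (v : Fin m → ℕ)
    (k : Fin m) : (i.insertNth j v : Fin (m + 1) → ℕ) + Pi.single (i.succAbove k) 1 =
      i.insertNth j (v + Pi.single k 1) := by
  funext l
  rcases Fin.eq_self_or_eq_succAbove i l with rfl | ⟨l, rfl⟩
  · simp
  · by_cases h : l = k
    · subst h; simp
    · have : i.succAbove l ≠ i.succAbove k := fun h' => h (Fin.succAbove_right_injective h')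
      simp [Pi.single_eq_of_ne h, Pi.single_eq_of_ne this]

/-! ### The lexicographic order -/

theorem lex_lt_iff {m : ℕ} {u v : Fin m → ℕ} :
    toLex u < toLex v ↔ ∃ k, (∀ j < k, u j = v j) ∧ u k < v k := Iff.rfl

theorem lex_insertNth {m : ℕ} (i : Fin (m + 1)) (j : ℕ) {u v : Fin m → ℕ}
    (h : toLex u < toLex v) :
    toLex (i.insertNth j u : Fin (m + 1) → ℕ) < toLex (i.insertNth j v : Fin (m + 1) → ℕ) := by
  rw [lex_lt_iff] at h ⊢
  obtain ⟨k, hk, hlt⟩ := h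
  refine ⟨i.succAbove k, fun l hl => ?_, by simpa using hlt⟩
  rcases Fin.eq_self_or_eq_succAbove i l with rfl | ⟨l, rfl⟩
  · simp
  · simpa using hk l (Fin.succAbove_lt_succAbove_iff.1 hl)

/-- Moving a unit from the entry `k` to an earlier entry `i` increases a vector. -/
theorem lex_move {m : ℕ} (w : Fin m → ℕ) {i k : Fin m} (h : i < k) :
    toLex (w + Pi.single k 1) < toLex (w + Pi.single i 1) := by
  rw [lex_lt_iff]
  refine ⟨i, fun j hj => ?_, ?_⟩
  · simp [Pi.single_eq_of_ne hj.ne, Pi.single_eq_of_ne (hj.trans h).ne]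
  · simp [Pi.single_eq_of_ne h.ne]

/-- Since the degrees agree, a deficit at the first difference must be compensated at a later entry.
-/
theorem exists_lt_of_lex_lt {m : ℕ} {z w : Fin m → ℕ} (hd : deg z = deg w)
    (h : toLex z < toLex w) :
    ∃ t, (∀ j < t, z j = w j) ∧ z t < w t ∧ ∃ l, t < l ∧ w l < z l := by
  obtain ⟨t, h1, h2⟩ := lex_lt_iff.1 h
  refine ⟨t, h1, h2, ?_⟩
  by_contra hc
  push Not at hc
  have : deg z < deg w := by
    refine Finset.sum_lt_sum (fun i _ => ?_) ⟨t, Finset.mem_univ _, h2⟩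
    rcases lt_trichotomy i t with h | rfl | h
    · exact (h1 i h).le
    · exact h2.le
    · exact hc i h
  omega

/-! ### Homogeneous sets, upper shadows and slices -/

/-- The vectors of degree `d`. -/
def monos (m d : ℕ) : Finset (Fin m → ℕ) := Finset.piAntidiag Finset.univ d

@[simp] theorem mem_monos {m d : ℕ} {u : Fin m → ℕ} : u ∈ monos m d ↔ deg u = d := by
  simp [monos, deg]

/-- All members of the set have degree `d`. -/
def Homog {m : ℕ} (d : ℕ) (A : Finset (Fin m → ℕ)) : Prop := ∀ u ∈ A, deg u = d

theorem Homog.subset_monos {m d : ℕ} {A : Finset (Fin m → ℕ)} (h : Homog d A) :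
    A ⊆ monos m d := fun u hu => mem_monos.2 (h u hu)

/-- The upper shadow: all vectors obtained by adding a unit vector to a member of the set. -/
def up {m : ℕ} (A : Finset (Fin m → ℕ)) : Finset (Fin m → ℕ) :=
  A.biUnion fun u => Finset.univ.image fun i => u + Pi.single i 1

theorem mem_up {m : ℕ} {A : Finset (Fin m → ℕ)} {v : Fin m → ℕ} :
    v ∈ up A ↔ ∃ u ∈ A, ∃ i, u + Pi.single i 1 = v := by
  simp [up]

theorem add_single_mem_up {m : ℕ} {A : Finset (Fin m → ℕ)} {v : Fin m → ℕ} (h : v ∈ A)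
    (i : Fin m) : v + Pi.single i 1 ∈ up A := mem_up.2 ⟨v, h, i, rfl⟩

theorem up_mono {m : ℕ} {A B : Finset (Fin m → ℕ)} (h : A ⊆ B) : up A ⊆ up B :=
  Finset.biUnion_subset_biUnion_of_subset_left _ h

theorem Homog.up {m d : ℕ} {A : Finset (Fin m → ℕ)} (h : Homog d A) : Homog (d + 1) (up A) := by
  intro v hv
  obtain ⟨u, hu, i, rfl⟩ := mem_up.1 hv
  rw [deg_add_single, h u hu]

theorem Homog.mem_up_iff {m d : ℕ} {A : Finset (Fin m → ℕ)} (h : Homog d A) {v : Fin m → ℕ} :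
    v ∈ DiffKernel.up A ↔ deg v = d + 1 ∧ ∃ u ∈ A, u ≤ v := by
  constructor
  · intro hv
    refine ⟨h.up v hv, ?_⟩
    obtain ⟨u, hu, i, rfl⟩ := mem_up.1 hv
    exact ⟨u, hu, by simp⟩
  · rintro ⟨hd, u, hu, hle⟩
    obtain ⟨i, hi⟩ := exists_lt_of_deg_lt (u := u) (v := v) (by rw [h u hu]; omega)
    refine mem_up.2 ⟨u, hu, i, eq_of_le_of_deg_le (add_single_le hle hi) ?_⟩
    rw [deg_add_single, h u hu, hd]

/-- The slice of a set where the entry `i` equals `j`. -/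
def sliceAt {m : ℕ} (i : Fin (m + 1)) (j : ℕ) (A : Finset (Fin (m + 1) → ℕ)) :
    Finset (Fin m → ℕ) := (A.filter fun u => u i = j).image i.removeNth

theorem mem_sliceAt {m : ℕ} {i : Fin (m + 1)} {j : ℕ} {A : Finset (Fin (m + 1) → ℕ)}
    {v : Fin m → ℕ} : v ∈ sliceAt i j A ↔ (i.insertNth j v : Fin (m + 1) → ℕ) ∈ A := by
  simp only [sliceAt, Finset.mem_image, Finset.mem_filter]
  constructor
  · rintro ⟨u, ⟨hu, rfl⟩, rfl⟩
    rwa [Fin.insertNth_self_removeNth]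
  · intro h
    exact ⟨_, ⟨h, by simp⟩, by simp⟩

theorem removeNth_mem_sliceAt {m : ℕ} (i : Fin (m + 1)) {A : Finset (Fin (m + 1) → ℕ)}
    {u : Fin (m + 1) → ℕ} : i.removeNth u ∈ sliceAt i (u i) A ↔ u ∈ A := by
  rw [mem_sliceAt, Fin.insertNth_self_removeNth]

theorem Homog.sliceAt {m d : ℕ} {A : Finset (Fin (m + 1) → ℕ)} (h : Homog d A)
    (i : Fin (m + 1)) (j : ℕ) : Homog (d - j) (sliceAt i j A) := by
  intro v hv
  have := h _ (mem_sliceAt.1 hv)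
  rw [deg_insertNth] at this
  omega

theorem Homog.le_of_mem_sliceAt {m d : ℕ} {A : Finset (Fin (m + 1) → ℕ)} (h : Homog d A)
    {i : Fin (m + 1)} {j : ℕ} {v : Fin m → ℕ} (hv : v ∈ DiffKernel.sliceAt i j A) :
    j + deg v = d := by
  have := h _ (mem_sliceAt.1 hv)
  rwa [deg_insertNth] at this

theorem card_sliceAt {m : ℕ} (i : Fin (m + 1)) (j : ℕ) (A : Finset (Fin (m + 1) → ℕ)) :
    (sliceAt i j A).card = (A.filter fun u => u i = j).card := by
  refine Finset.card_image_of_injOn ?_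
  intro u hu v hv huv
  simp only [Finset.coe_filter, Set.mem_ofPred_eq] at hu hv
  rw [← Fin.insertNth_self_removeNth i u, ← Fin.insertNth_self_removeNth i v, huv, hu.2, hv.2]

theorem Homog.card_eq_sum {m d N : ℕ} {A : Finset (Fin (m + 1) → ℕ)} (h : Homog d A)
    (i : Fin (m + 1)) (hN : d < N) :
    A.card = ∑ j ∈ Finset.range N, (DiffKernel.sliceAt i j A).card := by
  simp only [card_sliceAt]
  refine Finset.card_eq_sum_card_fiberwise fun u hu => ?_
  have := h u hu
  rw [deg_eq_add_removeNth i] at this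
  simp
  omega

theorem sliceAt_up_zero {m : ℕ} (i : Fin (m + 1)) (A : Finset (Fin (m + 1) → ℕ)) :
    sliceAt i 0 (up A) = up (sliceAt i 0 A) := by
  ext v
  rw [mem_sliceAt, mem_up, mem_up]
  constructor
  · rintro ⟨u, hu, k, hk⟩
    obtain ⟨j, w, rfl⟩ : ∃ j w, u = (i.insertNth j w : Fin (m + 1) → ℕ) :=
      ⟨u i, i.removeNth u, (Fin.insertNth_self_removeNth i u).symm⟩
    rcases Fin.eq_self_or_eq_succAbove i k with rfl | ⟨l, rfl⟩
    · rw [insertNth_add_single_self] at hk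
      exact absurd (Fin.insertNth_injective2 hk).1 (by omega)
    · rw [insertNth_add_single_succAbove] at hk
      obtain ⟨rfl, h2⟩ := Fin.insertNth_injective2 hk
      exact ⟨w, mem_sliceAt.2 hu, l, h2⟩
  · rintro ⟨u, hu, k, rfl⟩
    exact ⟨_, mem_sliceAt.1 hu, i.succAbove k, insertNth_add_single_succAbove i 0 u k⟩

/-- The unit is added either in the entry `i`, coming from slice `j`, or elsewhere, staying in slice
`j + 1`. This recursion drives every induction on the number of variables. -/
theorem sliceAt_up_succ {m : ℕ} (i : Fin (m + 1)) (j : ℕ) (A : Finset (Fin (m + 1) → ℕ)) :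
    sliceAt i (j + 1) (up A) = sliceAt i j A ∪ up (sliceAt i (j + 1) A) := by
  ext v
  rw [mem_sliceAt, mem_up, Finset.mem_union, mem_up]
  constructor
  · rintro ⟨u, hu, k, hk⟩
    obtain ⟨j', w, rfl⟩ : ∃ j w, u = (i.insertNth j w : Fin (m + 1) → ℕ) :=
      ⟨u i, i.removeNth u, (Fin.insertNth_self_removeNth i u).symm⟩
    rcases Fin.eq_self_or_eq_succAbove i k with rfl | ⟨l, rfl⟩
    · rw [insertNth_add_single_self] at hk
      obtain ⟨h1, rfl⟩ := Fin.insertNth_injective2 hk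
      obtain rfl : j' = j := by omega
      exact Or.inl (mem_sliceAt.2 hu)
    · rw [insertNth_add_single_succAbove] at hk
      obtain ⟨rfl, h2⟩ := Fin.insertNth_injective2 hk
      exact Or.inr ⟨w, mem_sliceAt.2 hu, l, h2⟩
  · rintro (h | ⟨u, hu, k, rfl⟩)
    · exact ⟨_, mem_sliceAt.1 h, i, insertNth_add_single_self i j v⟩
    · exact ⟨_, mem_sliceAt.1 hu, i.succAbove k, insertNth_add_single_succAbove i _ u k⟩

/-! ### Lexicographic segments -/

/-- A set of vectors of degree `d` closed under passing to lexicographically larger ones. -/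
def IsSeg {m : ℕ} (d : ℕ) (L : Finset (Fin m → ℕ)) : Prop :=
  Homog d L ∧ ∀ u v, deg u = d → v ∈ L → toLex v < toLex u → u ∈ L

theorem IsSeg.total {m d : ℕ} {L L' : Finset (Fin m → ℕ)} (h : IsSeg d L) (h' : IsSeg d L') :
    L ⊆ L' ∨ L' ⊆ L := by
  by_contra hc
  push Not at hc
  obtain ⟨⟨u, hu, hu'⟩, ⟨v, hv, hv'⟩⟩ :=
    And.intro (Finset.not_subset.1 hc.1) (Finset.not_subset.1 hc.2)
  rcases lt_trichotomy (toLex u) (toLex v) with hlt | heq | hlt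
  · exact hv' (h.2 v u (h'.1 v hv) hu hlt)
  · rw [toLex_inj] at heq
    exact hu' (heq ▸ hv)
  · exact hu' (h'.2 u v (h.1 u hu) hv hlt)

theorem IsSeg.subset_of_card_le {m d : ℕ} {L L' : Finset (Fin m → ℕ)} (h : IsSeg d L)
    (h' : IsSeg d L') (hc : L.card ≤ L'.card) : L ⊆ L' := by
  rcases h.total h' with hs | hs
  · exact hs
  · rw [Finset.eq_of_subset_of_card_le hs hc]

theorem IsSeg.eq_of_card_eq {m d : ℕ} {L L' : Finset (Fin m → ℕ)} (h : IsSeg d L)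
    (h' : IsSeg d L') (hc : L.card = L'.card) : L = L' :=
  (h.subset_of_card_le h' hc.le).antisymm (h'.subset_of_card_le h hc.ge)

theorem isSeg_empty (m d : ℕ) : IsSeg d (∅ : Finset (Fin m → ℕ)) := by
  constructor
  · intro u hu; simp at hu
  · intro u v _ hv; simp at hv

theorem isSeg_monos (m d : ℕ) : IsSeg d (monos m d) :=
  ⟨fun _ hu => mem_monos.1 hu, fun _ _ hu _ _ => mem_monos.2 hu⟩

/-- Greedy: adjoin the lexicographically largest vector not yet present. -/
theorem exists_isSeg {m d a : ℕ} (h : a ≤ (monos m d).card) :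
    ∃ L : Finset (Fin m → ℕ), IsSeg d L ∧ L.card = a := by
  induction a with
  | zero => exact ⟨∅, isSeg_empty m d, rfl⟩
  | succ a ih =>
    obtain ⟨L, hL, rfl⟩ := ih (by omega)
    have hne : (monos m d \ L).Nonempty := by
      rw [← Finset.card_pos]
      have := Finset.le_card_sdiff L (monos m d)
      omega
    obtain ⟨x, hx, hmax⟩ := Finset.exists_max_image _ toLex hne
    rw [Finset.mem_sdiff, mem_monos] at hx
    refine ⟨insert x L, ⟨?_, ?_⟩, by rw [Finset.card_insert_of_notMem hx.2]⟩
    · intro u hu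
      rcases Finset.mem_insert.1 hu with rfl | hu
      · exact hx.1
      · exact hL.1 u hu
    · intro u v hu hv hlt
      rw [Finset.mem_insert]
      rcases Finset.mem_insert.1 hv with rfl | hv
      · right
        by_contra hn
        exact absurd (hmax u (by simp [hu, hn])) (not_le.2 hlt)
      · exact Or.inr (hL.2 u v hu hv hlt)

theorem Homog.exists_isSeg_card_eq {m d : ℕ} {A : Finset (Fin m → ℕ)} (h : Homog d A) :
    ∃ L : Finset (Fin m → ℕ), IsSeg d L ∧ L.card = A.card :=
  exists_isSeg (Finset.card_le_card h.subset_monos)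

theorem IsSeg.sliceAt {m d : ℕ} {L : Finset (Fin (m + 1) → ℕ)} (h : IsSeg d L)
    (i : Fin (m + 1)) (j : ℕ) : IsSeg (d - j) (DiffKernel.sliceAt i j L) := by
  refine ⟨h.1.sliceAt i j, fun u v hu hv hlt => ?_⟩
  have hd := h.1.le_of_mem_sliceAt hv
  rw [mem_sliceAt] at hv ⊢
  exact h.2 _ _ (by rw [deg_insertNth]; omega) hv (lex_insertNth i j hlt)

/-- The upper shadow of a segment is a segment. -/
theorem IsSeg.up {m d : ℕ} {L : Finset (Fin m → ℕ)} (h : IsSeg d L) :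
    IsSeg (d + 1) (up L) := by
  refine ⟨h.1.up, fun w z hw hz hlt => ?_⟩
  obtain ⟨v, hv, i, rfl⟩ := mem_up.1 hz
  have hvd := h.1 v hv
  obtain ⟨t, h1, h2, l, htl, hl⟩ := exists_lt_of_lex_lt (by rw [deg_add_single, hvd, hw]) hlt
  -- remove a unit from the last nonzero entry of `w`
  have hex : ∃ k, 0 < w k ∧ ∀ j, k < j → w j = 0 := by
    have hne : (Finset.univ.filter fun k => 0 < w k).Nonempty := ⟨t, by simp; omega⟩
    obtain ⟨k, hk, hmax⟩ := Finset.exists_max_image _ id hne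
    refine ⟨k, by simpa using hk, fun j hj => ?_⟩
    by_contra hc
    exact absurd (hmax j (by simp; omega)) (by simpa using hj)
  obtain ⟨k, hk, hk0⟩ := hex
  have htk : t ≤ k := by
    by_contra hc
    have := hk0 t (by omega)
    omega
  obtain ⟨w', rfl⟩ := exists_eq_add_single hk
  have hw' : deg w' = d := by rw [deg_add_single] at hw; omega
  refine add_single_mem_up ?_ k
  by_contra hnot
  -- otherwise `w' < v`, which contradicts `v + e_i < w' + e_k`
  have hvw : toLex w' < toLex v := by
    rcases lt_trichotomy (toLex w') (toLex v) with hc | hc | hc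
    · exact hc
    · rw [toLex_inj] at hc; exact absurd (hc ▸ hv) hnot
    · exact absurd (h.2 w' v hw' hv hc) hnot
  obtain ⟨s, g1, g2, l', hsl, hl'⟩ := exists_lt_of_lex_lt (by rw [hw', hvd]) hvw
  have e1 : ∀ j, (v + Pi.single i 1 : Fin m → ℕ) j = v j + (Pi.single i 1 : Fin m → ℕ) j :=
    fun j => rfl
  have e2 : ∀ j, (w' + Pi.single k 1 : Fin m → ℕ) j = w' j + (Pi.single k 1 : Fin m → ℕ) j :=
    fun j => rfl
  have e3 : ∀ j, j ≠ k → (Pi.single k 1 : Fin m → ℕ) j = 0 := fun j hj => Pi.single_eq_of_ne hj _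
  have e4 : (Pi.single k 1 : Fin m → ℕ) k = 1 := Pi.single_eq_same _ _
  -- entries of `w'` after `k` vanish, so `s < k`
  have hsk : s < k := by
    by_contra hc
    have := hk0 l' (by omega)
    rw [e2] at this
    omega
  rcases lt_trichotomy s t with hst | hst | hst
  · have := h1 s hst
    rw [e1, e2, e3 s hsk.ne] at this
    omega
  · subst hst
    rw [e1, e2, e3 s hsk.ne] at h2
    omega
  · have := g1 t hst
    rw [e1, e2, e3 t (hst.trans hsk).ne] at h2
    omega

/-- Enlarging a segment enlarges its upper shadow at least as much. -/
theorem IsSeg.card_up_add_le {m d : ℕ} {L L' : Finset (Fin (m + 1) → ℕ)} (h : IsSeg d L)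
    (h' : IsSeg d L') {c : ℕ} (hc : L.card + c ≤ L'.card) :
    (DiffKernel.up L).card + c ≤ (DiffKernel.up L').card := by
  have hsub := h.subset_of_card_le h' (by omega)
  -- The shadow gains at least the new vectors multiplied by the last variable. Such a product
  -- cannot already lie in `up L`, since its other divisors of degree `d` are lexicographically
  -- smaller than the new vector.
  have hdisj : Disjoint (DiffKernel.up L)
      ((L' \ L).image fun v => v + Pi.single (Fin.last m) 1) := by
    rw [Finset.disjoint_right]
    intro z hz hz'
    obtain ⟨v, hv, rfl⟩ := Finset.mem_image.1 hz
    rw [Finset.mem_sdiff] at hv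
    obtain ⟨w, hw, k, hk⟩ := mem_up.1 hz'
    rcases lt_trichotomy k (Fin.last m) with hlt | rfl | hlt
    · -- then `w < v`
      have hvk : 0 < v k := by
        have := congrFun hk k
        simp [Pi.single_eq_of_ne hlt.ne] at this
        omega
      obtain ⟨x, rfl⟩ := exists_eq_add_single hvk
      have hw' : w = x + Pi.single (Fin.last m) 1 := by
        rw [add_right_comm] at hk
        exact add_right_cancel hk
      refine hv.2 (h.2 _ w (h'.1 _ hv.1) hw ?_)
      rw [hw']
      exact lex_move x hlt
    · exact hv.2 (add_right_cancel hk ▸ hw)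
    · exact absurd hlt (not_lt.2 (Fin.le_last k))
  have hunion : DiffKernel.up L ∪ ((L' \ L).image fun v => v + Pi.single (Fin.last m) 1) ⊆
      DiffKernel.up L' := by
    refine Finset.union_subset (up_mono hsub) fun z hz => ?_
    obtain ⟨v, hv, rfl⟩ := Finset.mem_image.1 hz
    exact add_single_mem_up (Finset.mem_sdiff.1 hv).1 _
  have h1 := Finset.card_le_card hunion
  rw [Finset.card_union_of_disjoint hdisj,
    Finset.card_image_of_injective _ (add_left_injective _)] at h1
  have := Finset.le_card_sdiff L L'
  omega

/-! ### Compression -/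

/-- `A'` is obtained from `A` by replacing all slices in direction `i` by segments. -/
structure IsCompression {m : ℕ} (i : Fin (m + 1)) (d : ℕ) (A A' : Finset (Fin (m + 1) → ℕ)) :
    Prop where
  homog : Homog d A
  homog' : Homog d A'
  isSeg : ∀ j, IsSeg (d - j) (sliceAt i j A')
  card_eq : ∀ j, (sliceAt i j A').card = (sliceAt i j A).card

/-- All slices in direction `i` are segments. -/
def Compressed {m : ℕ} (i : Fin (m + 1)) (d : ℕ) (A : Finset (Fin (m + 1) → ℕ)) : Prop :=
  ∀ j, IsSeg (d - j) (sliceAt i j A)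

theorem exists_isCompression {m d : ℕ} (i : Fin (m + 1)) {A : Finset (Fin (m + 1) → ℕ)}
    (h : Homog d A) : ∃ A', IsCompression i d A A' := by
  choose L hL hcard using fun j => (h.sliceAt i j).exists_isSeg_card_eq
  let A' : Finset (Fin (m + 1) → ℕ) :=
    (Finset.range (d + 1)).biUnion fun j => (L j).image fun v => i.insertNth j v
  have hmem : ∀ j v, (i.insertNth j v : Fin (m + 1) → ℕ) ∈ A' ↔ v ∈ L j := by
    intro j v
    simp only [A', Finset.mem_biUnion, Finset.mem_image, Finset.mem_range]
    constructor
    · rintro ⟨j', _, v', hv', he⟩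
      obtain ⟨rfl, rfl⟩ := Fin.insertNth_injective2 he
      exact hv'
    · intro hv
      refine ⟨j, ?_, v, hv, rfl⟩
      have : 0 < (sliceAt i j A).card := by
        rw [← hcard]; exact Finset.card_pos.2 ⟨v, hv⟩
      obtain ⟨x, hx⟩ := Finset.card_pos.1 this
      have := h.le_of_mem_sliceAt hx
      omega
  have hsl : ∀ j, sliceAt i j A' = L j := fun j => by
    ext v; rw [mem_sliceAt, hmem]
  refine ⟨A', h, ?_, fun j => by rw [hsl]; exact hL j, fun j => by rw [hsl]; exact hcard j⟩
  intro u hu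
  rw [← Fin.insertNth_self_removeNth i u, hmem] at hu
  have hpos : 0 < (sliceAt i (u i) A).card := by
    rw [← hcard]; exact Finset.card_pos.2 ⟨_, hu⟩
  obtain ⟨x, hx⟩ := Finset.card_pos.1 hpos
  have h1 := h.le_of_mem_sliceAt hx
  have h2 := (hL (u i)).1 _ hu
  rw [deg_eq_add_removeNth i, h2]
  omega

namespace IsCompression

variable {m d : ℕ} {i : Fin (m + 1)} {A A' : Finset (Fin (m + 1) → ℕ)}

theorem card (h : IsCompression i d A A') : A'.card = A.card := by
  rw [h.homog.card_eq_sum i (Nat.lt_succ_self d), h.homog'.card_eq_sum i (Nat.lt_succ_self d)]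
  exact Finset.sum_congr rfl fun j _ => h.card_eq j

theorem isSeg_up (h : IsCompression i d A A') (j : ℕ) :
    IsSeg (d - j) (up (sliceAt i (j + 1) A')) := by
  by_cases hj : j + 1 ≤ d
  · have := (h.isSeg (j + 1)).up
    rwa [show d - (j + 1) + 1 = d - j by omega] at this
  -- Here the subtraction `d - (j + 1)` may truncate, so the degrees need not match, but the slice
  -- is empty.
  · have he : sliceAt i (j + 1) A' = ∅ := by
      rw [Finset.eq_empty_iff_forall_notMem]
      intro v hv
      have := h.homog'.le_of_mem_sliceAt hv
      omega
    rw [he]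
    exact isSeg_empty _ _

end IsCompression

theorem lex_removeNth {m : ℕ} (i : Fin (m + 1)) {u v : Fin (m + 1) → ℕ} (hi : u i = v i)
    (h : toLex u < toLex v) : toLex (i.removeNth u) < toLex (i.removeNth v) := by
  rcases lt_trichotomy (toLex (i.removeNth u)) (toLex (i.removeNth v)) with hc | hc | hc
  · exact hc
  · rw [toLex_inj] at hc
    rw [← Fin.insertNth_self_removeNth i u, ← Fin.insertNth_self_removeNth i v, hc, hi] at h
    exact absurd h (lt_irrefl _)
  · have := lex_insertNth i (u i) hc
    rw [Fin.insertNth_self_removeNth, hi, Fin.insertNth_self_removeNth] at this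
    exact absurd h this.asymm

/-- The form in which compression is used: among vectors sharing the entry `i`, the set behaves like
a segment. -/
theorem Compressed.mem {m d : ℕ} {i : Fin (m + 1)} {A : Finset (Fin (m + 1) → ℕ)}
    (h : Compressed i d A) {u v : Fin (m + 1) → ℕ} (hv : v ∈ A) (hu : deg u = d)
    (hi : u i = v i) (hlt : toLex v < toLex u) : u ∈ A := by
  rw [← removeNth_mem_sliceAt i, hi]
  refine (h (v i)).2 _ (i.removeNth v) ?_ ((removeNth_mem_sliceAt i).2 hv)
    (lex_removeNth i hi.symm hlt)
  rw [deg_eq_add_removeNth i, hi] at hu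
  omega

theorem IsSeg.compressed {m d : ℕ} {L : Finset (Fin (m + 1) → ℕ)} (h : IsSeg d L)
    (i : Fin (m + 1)) : Compressed i d L := fun j => h.sliceAt i j

/-- A measure which decreases under compression: the number of sets which are larger in the
colexicographic order. -/
noncomputable def colexRank (m d : ℕ) (A : Finset (Fin m → ℕ)) : ℕ :=
  ((monos m d).powerset.filter fun B =>
    toColex (A.map toLex.toEmbedding) < toColex (B.map toLex.toEmbedding)).card

/-- Each vector lost is outweighed by a lexicographically larger one gained in the same slice, so
the set moves up in the colexicographic order. As there are finitely many sets in each degree,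
compressing terminates. -/
theorem IsCompression.colexRank_lt {m d : ℕ} {i : Fin (m + 1)}
    {A A' : Finset (Fin (m + 1) → ℕ)} (h : IsCompression i d A A') (hne : A ≠ A') :
    colexRank (m + 1) d A' < colexRank (m + 1) d A := by
  have hlt : toColex (A.map toLex.toEmbedding) < toColex (A'.map toLex.toEmbedding) := by
    rw [Finset.Colex.toColex_lt_toColex]
    refine ⟨fun he => hne (Finset.map_injective _ he), ?_⟩
    intro a ha ha'
    obtain ⟨u, hu, rfl⟩ := Finset.mem_map.1 ha
    have hu' : u ∉ A' := fun h' => ha' (Finset.mem_map_of_mem _ h')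
    have hsl : i.removeNth u ∈ sliceAt i (u i) A := (removeNth_mem_sliceAt i).2 hu
    have hsl' : i.removeNth u ∉ sliceAt i (u i) A' := mt (removeNth_mem_sliceAt i).1 hu'
    obtain ⟨v, hv, hv'⟩ : ∃ v ∈ sliceAt i (u i) A', v ∉ sliceAt i (u i) A := by
      by_contra hc
      push Not at hc
      exact hsl' (Finset.eq_of_subset_of_card_le hc (h.card_eq _).ge ▸ hsl)
    refine ⟨toLex (i.insertNth (u i) v), Finset.mem_map_of_mem _ (mem_sliceAt.1 hv),
      fun h' => hv' (mem_sliceAt.2 ?_), ?_⟩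
    · obtain ⟨x, hx, hxe⟩ := Finset.mem_map.1 h'
      have : x = (i.insertNth (u i) v : Fin (m + 1) → ℕ) := toLex.injective hxe
      exact this ▸ hx
    · rcases lt_trichotomy (toLex (i.removeNth u)) (toLex v) with hc | hc | hc
      · have := lex_insertNth i (u i) hc
        rw [Fin.insertNth_self_removeNth] at this
        exact this.le
      · rw [toLex_inj] at hc
        exact absurd (hc ▸ hv) hsl'
      · exact absurd ((h.isSeg _).2 _ v (h.homog.sliceAt i _ _ hsl) hv hc) hsl'
  -- `A'` itself is counted for `A` but not for `A'`.
  refine Finset.card_lt_card (Finset.ssubset_iff_of_subset ?_ |>.2 ⟨A', ?_, ?_⟩)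
  · intro B hB
    rw [Finset.mem_filter] at hB ⊢
    exact ⟨hB.1, hlt.trans hB.2⟩
  · rw [Finset.mem_filter, Finset.mem_powerset]
    exact ⟨h.homog'.subset_monos, hlt⟩
  · simp

/-- To prove something about all homogeneous sets, one may pass to compressions. -/
theorem compression_induction {m d : ℕ} {P : Finset (Fin (m + 1) → ℕ) → Prop}
    (base : ∀ A, Homog d A → (∀ i, Compressed i d A) → P A)
    (step : ∀ A A' i, IsCompression i d A A' → P A' → P A)
    (A : Finset (Fin (m + 1) → ℕ)) (hA : Homog d A) : P A := by
  induction hn : colexRank (m + 1) d A using Nat.strong_induction_on generalizing A with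
  | _ n ih =>
    by_cases hc : ∀ i, Compressed i d A
    · exact base A hA hc
    · push Not at hc
      obtain ⟨i, hi⟩ := hc
      obtain ⟨A', hA'⟩ := exists_isCompression i hA
      have hne : A ≠ A' := fun h => hi (h ▸ hA'.isSeg)
      exact step A A' i hA' (ih _ (hn ▸ hA'.colexRank_lt hne) A' hA'.homog' rfl)

/-! ### Macaulay's theorem -/

/-- Among the sets of a given size in a given degree, segments have the smallest shadow. -/
def Macaulay (m : ℕ) : Prop :=
  ∀ (d : ℕ) (A L : Finset (Fin m → ℕ)), Homog d A → IsSeg d L → L.card ≤ A.card →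
    (up L).card ≤ (up A).card

/-- A surplus of `c` vectors survives in the shadow: compare first with the segment of the same size
as `A`, then compare the two segments. -/
theorem Macaulay.card_add_le {m : ℕ} (hM : Macaulay (m + 1)) {d c : ℕ}
    {A L : Finset (Fin (m + 1) → ℕ)} (hA : Homog d A) (hL : IsSeg d L)
    (h : L.card + c ≤ A.card) : (up L).card + c ≤ (up A).card := by
  obtain ⟨L', hL', hc⟩ := hA.exists_isSeg_card_eq
  exact (hL.card_up_add_le hL' (hc ▸ h)).trans (hM d A L' hA hL' hc.le)

/-- After compression the two sets making up a slice of the shadow are segments of one degree, hence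
nested, and their union is the larger one. Each of them is no larger than its counterpart before
compression: slice `j` keeps its size, and for the shadow of slice `j + 1` this is Macaulay in `m`
variables. -/
theorem IsCompression.card_sliceAt_up_le {m d : ℕ} {i : Fin (m + 1)}
    {A A' : Finset (Fin (m + 1) → ℕ)} (h : IsCompression i d A A') (hM : Macaulay m) (j : ℕ) :
    (sliceAt i j (up A')).card ≤ (sliceAt i j (up A)).card := by
  cases j with
  | zero =>
    rw [sliceAt_up_zero, sliceAt_up_zero]
    exact hM _ _ _ (h.homog.sliceAt i 0) (h.isSeg 0) (h.card_eq 0).le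
  | succ j =>
    rw [sliceAt_up_succ, sliceAt_up_succ]
    rcases (h.isSeg j).total (h.isSeg_up j) with hs | hs
    · rw [Finset.union_eq_right.2 hs]
      exact (hM _ _ _ (h.homog.sliceAt i _) (h.isSeg _) (h.card_eq _).le).trans
        (Finset.card_le_card Finset.subset_union_right)
    · rw [Finset.union_eq_left.2 hs, h.card_eq]
      exact Finset.card_le_card Finset.subset_union_left

theorem IsCompression.card_up_le {m d : ℕ} {i : Fin (m + 1)}
    {A A' : Finset (Fin (m + 1) → ℕ)} (h : IsCompression i d A A') (hM : Macaulay m) :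
    (up A').card ≤ (up A).card := by
  rw [h.homog.up.card_eq_sum i (Nat.lt_succ_self _), h.homog'.up.card_eq_sum i (Nat.lt_succ_self _)]
  exact Finset.sum_le_sum fun j _ => h.card_sliceAt_up_le hM j

/-- Stability with respect to moving a unit away from the last entry. -/
def LastStable {m : ℕ} (A : Finset (Fin (m + 1) → ℕ)) : Prop :=
  ∀ j, up (sliceAt (Fin.last m) (j + 1) A) ⊆ sliceAt (Fin.last m) j A

theorem up_sliceAt_subset {m : ℕ} (i : Fin (m + 1)) (j : ℕ) (A : Finset (Fin (m + 1) → ℕ)) :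
    up (sliceAt i j A) ⊆ sliceAt i j (up A) := by
  cases j with
  | zero => rw [sliceAt_up_zero]
  | succ j => rw [sliceAt_up_succ]; exact Finset.subset_union_right

theorem LastStable.sliceAt_up_succ {m : ℕ} {A : Finset (Fin (m + 1) → ℕ)} (h : LastStable A)
    (j : ℕ) : sliceAt (Fin.last m) (j + 1) (up A) = sliceAt (Fin.last m) j A := by
  rw [DiffKernel.sliceAt_up_succ, Finset.union_eq_left.2 (h j)]

theorem LastStable.up {m : ℕ} {A : Finset (Fin (m + 1) → ℕ)} (h : LastStable A) :
    LastStable (up A) := by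
  intro j
  rw [h.sliceAt_up_succ]
  exact up_sliceAt_subset _ _ _

/-- The part of the shadow with positive last entry is a translate of `A`, so the size of the shadow
depends only on that of `A` and on the slice with last entry `0`. -/
theorem LastStable.card_up {m d : ℕ} {A : Finset (Fin (m + 1) → ℕ)} (h : LastStable A)
    (hA : Homog d A) :
    (DiffKernel.up A).card = A.card + (DiffKernel.up (sliceAt (Fin.last m) 0 A)).card := by
  rw [hA.up.card_eq_sum (Fin.last m) (Nat.lt_succ_self _), Finset.sum_range_succ',
    hA.card_eq_sum (Fin.last m) (Nat.lt_succ_self _), sliceAt_up_zero]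
  simp only [h.sliceAt_up_succ]

theorem exists_ne_ne {m : ℕ} (hm : 2 ≤ m) (a b : Fin (m + 1)) : ∃ c, c ≠ a ∧ c ≠ b := by
  have : (({a, b} : Finset (Fin (m + 1)))ᶜ).Nonempty := by
    rw [← Finset.card_pos, Finset.card_compl, Fintype.card_fin]
    have := Finset.card_le_two (a := a) (b := b)
    omega
  obtain ⟨c, hc⟩ := this
  exact ⟨c, by simpa using hc⟩

/-- With at least three variables there is a direction `l` different from `i` and `k`; the move
preserves the entry `l`, so it takes place inside one slice, which is a segment. -/
theorem move_mem_of_compressed {m d : ℕ} (hm : 2 ≤ m) {A : Finset (Fin (m + 1) → ℕ)}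
    (hA : Homog d A) (hc : ∀ i, Compressed i d A) {w : Fin (m + 1) → ℕ} {i k : Fin (m + 1)}
    (hik : i < k) (hw : w + Pi.single k 1 ∈ A) : w + Pi.single i 1 ∈ A := by
  obtain ⟨l, hl1, hl2⟩ := exists_ne_ne hm i k
  refine (hc l).mem hw ?_ ?_ (lex_move w hik)
  · have := hA _ hw
    rwa [deg_add_single] at this ⊢
  · simp [Pi.single_eq_of_ne hl1, Pi.single_eq_of_ne hl2]

theorem lastStable_of_compressed {m d : ℕ} (hm : 2 ≤ m) {A : Finset (Fin (m + 1) → ℕ)}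
    (hA : Homog d A) (hc : ∀ i, Compressed i d A) : LastStable A := by
  intro j v hv
  obtain ⟨y, hy, k, rfl⟩ := mem_up.1 hv
  rw [mem_sliceAt] at hy ⊢
  rw [← insertNth_add_single_self] at hy
  rw [← insertNth_add_single_succAbove]
  exact move_mem_of_compressed hm hA hc
    (lt_of_le_of_ne (Fin.le_last _) (Fin.succAbove_ne _ _)) hy

/-- If some `u ∈ L` with last entry `0` were missing from `A`, then `A` would contain some `v ∉ L`,
which is lexicographically smaller than `u`. Improving `v` inside `A` by allowed moves leads to `u ∈
A`. -/
theorem sliceAt_last_zero_subset {m d : ℕ} (hm : 2 ≤ m) {A L : Finset (Fin (m + 1) → ℕ)}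
    (hA : Homog d A) (hc : ∀ i, Compressed i d A) (hL : IsSeg d L) (hcard : L.card ≤ A.card) :
    sliceAt (Fin.last m) 0 L ⊆ sliceAt (Fin.last m) 0 A := by
  intro u₀ hu₀
  rw [mem_sliceAt] at hu₀ ⊢
  set u : Fin (m + 1) → ℕ := (Fin.last m).insertNth 0 u₀ with hu
  have hul : u (Fin.last m) = 0 := by simp [hu]
  have hud := hL.1 u hu₀
  clear_value u
  -- Induction on the last entry of `v`. If the first entries of `u` and `v` agree, compression in
  -- direction `0` suffices. Otherwise moving a unit from the last entry to a middle entry `p`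
  -- leaves the first entry, and so `v < u`, intact. At last entry `0`, compression in the last
  -- direction suffices.
  have key : ∀ N, ∀ v ∈ A, v (Fin.last m) = N → toLex v < toLex u → u ∈ A := by
    intro N
    induction N with
    | zero => exact fun v hv h0 hlt => (hc _).mem hv hud (hul.trans h0.symm) hlt
    | succ N ih =>
      intro v hv hN hlt
      by_cases h0 : u 0 = v 0
      · exact (hc 0).mem hv hud h0 hlt
      have h0' : v 0 < u 0 := by
        obtain ⟨t, h1, h2⟩ := lex_lt_iff.1 hlt
        rcases eq_or_ne t 0 with rfl | ht
        · exact h2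
        · exact absurd (h1 0 (Fin.pos_of_ne_zero ht)).symm h0
      obtain ⟨w, rfl⟩ := exists_eq_add_single (i := Fin.last m) (u := v) (by omega)
      obtain ⟨p, hp0, hpl⟩ := exists_ne_ne hm 0 (Fin.last m)
      refine ih (w + Pi.single p 1) (move_mem_of_compressed hm hA hc
        (lt_of_le_of_ne (Fin.le_last _) hpl) hv) ?_ ?_
      · simp [Pi.single_eq_of_ne hpl.symm] at hN ⊢
        exact hN
      · refine lex_lt_iff.2 ⟨0, fun j hj => absurd hj (Fin.not_lt_zero j), ?_⟩
        have hl0 : (0 : Fin (m + 1)) ≠ Fin.last m := by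
          intro h
          have := congrArg Fin.val h
          simp at this
          omega
        simp [Pi.single_eq_of_ne hp0.symm, Pi.single_eq_of_ne hl0] at h0' ⊢
        exact h0'
  by_contra hnot
  obtain ⟨v, hv, hvL⟩ : ∃ v ∈ A, v ∉ L := by
    by_contra hcon
    push Not at hcon
    exact hnot (Finset.eq_of_subset_of_card_le hcon hcard ▸ hu₀)
  rcases lt_trichotomy (toLex v) (toLex u) with hlt | heq | hlt
  · exact hnot (key _ v hv rfl hlt)
  · rw [toLex_inj] at heq
    exact hnot (heq ▸ hv)
  · exact hvL (hL.2 v u (hA v hv) hu₀ hlt)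

theorem macaulay_succ {m : ℕ} (hm : 2 ≤ m) (hM : Macaulay m) : Macaulay (m + 1) := by
  intro d A L hA hL
  revert A
  refine compression_induction (fun A hA hc hcard => ?_) fun A A' i h ih hcard =>
    (ih (h.card ▸ hcard)).trans (h.card_up_le hM)
  rw [(lastStable_of_compressed hm hA hc).card_up hA,
    (lastStable_of_compressed hm hL.1 hL.compressed).card_up hL.1]
  exact Nat.add_le_add hcard
    (Finset.card_le_card (up_mono (sliceAt_last_zero_subset hm hA hc hL hcard)))

/-! ### Two variables -/

/-- The translate of `A` by the first unit vector together with one more vector. -/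
def shiftInsert (A : Finset (Fin 2 → ℕ)) (v : Fin 2 → ℕ) : Finset (Fin 2 → ℕ) :=
  insert (v + Pi.single 1 1) (A.image fun u => u + Pi.single 0 1)

theorem lex_lt_two {u v : Fin 2 → ℕ} (hd : deg u = deg v) : toLex u < toLex v ↔ u 0 < v 0 := by
  constructor
  · intro h
    obtain ⟨t, h1, h2, l, h3, -⟩ := exists_lt_of_lex_lt hd h
    have : t = 0 := by omega
    exact this ▸ h2
  · intro h
    exact lex_lt_iff.2 ⟨0, fun j hj => absurd hj (Fin.not_lt_zero j), h⟩

theorem eq_of_zero_eq {u v : Fin 2 → ℕ} (hd : deg u = deg v) (h : u 0 = v 0) : u = v := by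
  simp only [deg, Fin.sum_univ_two] at hd
  funext i
  fin_cases i
  · exact h
  · simp; omega

theorem shiftInsert_subset {A : Finset (Fin 2 → ℕ)} {v : Fin 2 → ℕ} (hv : v ∈ A) :
    shiftInsert A v ⊆ up A := by
  intro x hx
  rcases Finset.mem_insert.1 hx with rfl | hx
  · exact add_single_mem_up hv 1
  · obtain ⟨u, hu, rfl⟩ := Finset.mem_image.1 hx
    exact add_single_mem_up hu 0

theorem card_shiftInsert {A : Finset (Fin 2 → ℕ)} {v : Fin 2 → ℕ}
    (hmin : ∀ u ∈ A, v 0 ≤ u 0) : (shiftInsert A v).card = A.card + 1 := by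
  rw [shiftInsert, Finset.card_insert_of_notMem,
    Finset.card_image_of_injective _ (add_left_injective _)]
  intro h
  obtain ⟨u, hu, he⟩ := Finset.mem_image.1 h
  have h1 := congrFun he 0
  have h2 := hmin u hu
  simp at h1
  omega

theorem exists_min_zero {A : Finset (Fin 2 → ℕ)} (h : A.Nonempty) :
    ∃ v ∈ A, ∀ u ∈ A, v 0 ≤ u 0 := Finset.exists_min_image A (fun u => u 0) h

theorem IsSeg.up_eq_shiftInsert {d : ℕ} {L : Finset (Fin 2 → ℕ)} (h : IsSeg d L)
    {v : Fin 2 → ℕ} (hv : v ∈ L) (hmin : ∀ u ∈ L, v 0 ≤ u 0) :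
    DiffKernel.up L = shiftInsert L v := by
  refine Finset.Subset.antisymm (fun x hx => ?_) (shiftInsert_subset hv)
  obtain ⟨u, hu, i, rfl⟩ := mem_up.1 hx
  rw [shiftInsert, Finset.mem_insert, Finset.mem_image]
  fin_cases i
  · exact Or.inr ⟨u, hu, rfl⟩
  · by_cases huv : u 0 = v 0
    · left
      rw [eq_of_zero_eq ((h.1 u hu).trans (h.1 v hv).symm) huv]
      rfl
    · right
      have hlt := hmin u hu
      obtain ⟨w, rfl⟩ := exists_eq_add_single (i := 0) (u := u) (by omega)
      refine ⟨w + Pi.single 1 1, ?_, add_right_comm _ _ _⟩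
      have hd : deg (w + Pi.single 1 1) = d := by
        have := h.1 _ hu
        rwa [deg_add_single] at this ⊢
      have hw0 : (w + Pi.single 1 1 : Fin 2 → ℕ) 0 = w 0 := by simp
      have hw1 : (w + Pi.single 0 1 : Fin 2 → ℕ) 0 = w 0 + 1 := by simp
      rw [hw1] at huv hlt
      by_cases he : w 0 = v 0
      · rw [eq_of_zero_eq (hd.trans (h.1 v hv).symm) (hw0.trans he)]
        exact hv
      · exact h.2 _ v hd hv ((lex_lt_two ((h.1 v hv).trans hd.symm)).2 (by omega))

theorem card_lt_card_up_two {A : Finset (Fin 2 → ℕ)} (h : A.Nonempty) :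
    A.card + 1 ≤ (up A).card := by
  obtain ⟨v, hv, hmin⟩ := exists_min_zero h
  rw [← card_shiftInsert hmin]
  exact Finset.card_le_card (shiftInsert_subset hv)

theorem IsSeg.card_up_two {d : ℕ} {L : Finset (Fin 2 → ℕ)} (h : IsSeg d L) (hne : L.Nonempty) :
    (DiffKernel.up L).card = L.card + 1 := by
  obtain ⟨v, hv, hmin⟩ := exists_min_zero hne
  rw [h.up_eq_shiftInsert hv hmin, card_shiftInsert hmin]

/-- The base case needs its own argument, as no third direction is available: a nonempty set grows
by at least one, and a segment by exactly one. -/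
theorem macaulay_two : Macaulay 2 := by
  intro d A L hA hL hcard
  rcases L.eq_empty_or_nonempty with rfl | hne
  · simp [up]
  · rw [hL.card_up_two hne]
    have hAne : A.Nonempty := Finset.card_pos.1 (hne.card_pos.trans_le hcard)
    exact (Nat.add_le_add_right hcard 1).trans (card_lt_card_up_two hAne)

theorem macaulay_of_two_le {m : ℕ} (hm : 2 ≤ m) : Macaulay m := by
  induction m, hm using Nat.le_induction with
  | base => exact macaulay_two
  | succ m hm ih => exact macaulay_succ hm ih

/-! ### Sets with minimal upper shadow -/

/-- A set of vectors of degree `d` whose upper shadow is as small as that of a segment. -/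
def Gotz {m : ℕ} (d : ℕ) (A : Finset (Fin m → ℕ)) : Prop :=
  Homog d A ∧ ∀ L : Finset (Fin m → ℕ), IsSeg d L → L.card = A.card → (up A).card ≤ (up L).card

/-- One step below `τ` between members of `A` whose least upper bound has degree at most
`d + 1`. -/
def LinStep {m : ℕ} (d : ℕ) (A : Finset (Fin m → ℕ)) (τ x y : Fin m → ℕ) : Prop :=
  x ∈ A ∧ x ≤ τ ∧ y ∈ A ∧ y ≤ τ ∧ deg (x ⊔ y) ≤ d + 1

theorem LinStep.symm {m d : ℕ} {A : Finset (Fin m → ℕ)} {τ x y : Fin m → ℕ}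
    (h : LinStep d A τ x y) : LinStep d A τ y x :=
  ⟨h.2.2.1, h.2.2.2.1, h.1, h.2.1, sup_comm x y ▸ h.2.2.2.2⟩

/-- Connected by steps below `τ`. -/
def Joined {m : ℕ} (d : ℕ) (A : Finset (Fin m → ℕ)) (τ : Fin m → ℕ) :
    (Fin m → ℕ) → (Fin m → ℕ) → Prop := Relation.ReflTransGen (LinStep d A τ)

theorem Joined.symm {m d : ℕ} {A : Finset (Fin m → ℕ)} {τ x y : Fin m → ℕ}
    (h : Joined d A τ x y) : Joined d A τ y x :=
  have : Std.Symm (LinStep d A τ) := ⟨fun _ _ h => LinStep.symm h⟩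
  Relation.ReflTransGen.stdSymm.symm _ _ h

/-- Members of `A` below a vector of degree at most `d + 2` are connected below it. -/
def LinConn {m : ℕ} (d : ℕ) (A : Finset (Fin m → ℕ)) : Prop :=
  ∀ τ, deg τ ≤ d + 2 → ∀ u ∈ A, ∀ v ∈ A, u ≤ τ → v ≤ τ → Joined d A τ u v

theorem Gotz.card_up_eq {m d : ℕ} (hM : Macaulay m) {A L : Finset (Fin m → ℕ)} (h : Gotz d A)
    (hL : IsSeg d L) (hc : L.card = A.card) : (up A).card = (up L).card :=
  (h.2 L hL hc).antisymm (hM d A L h.1 hL hc.le)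

/-! ### Slices of sets with minimal shadow, and linear connectedness -/

section Slices

variable {m d : ℕ} {i : Fin (m + 1)} {A A' : Finset (Fin (m + 1) → ℕ)}

theorem IsCompression.gotz (h : IsCompression i d A A') (hM : Macaulay m) (hA : Gotz d A) :
    Gotz d A' :=
  ⟨h.homog', fun L hL hc => (h.card_up_le hM).trans (hA.2 L hL (hc.trans h.card))⟩

theorem IsCompression.card_up_eq (h : IsCompression i d A A') (hM : Macaulay m)
    (hM' : Macaulay (m + 1)) (hA : Gotz d A) : (up A').card = (up A).card := by
  obtain ⟨L, hL, hc⟩ := hA.1.exists_isSeg_card_eq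
  rw [hA.card_up_eq hM' hL hc, (h.gotz hM hA).card_up_eq hM' hL (hc.trans h.card.symm)]

/-- Compression enlarges no slice of the shadow and, by minimality, preserves the total size; hence
it preserves the size of every slice. -/
theorem IsCompression.card_sliceAt_up_eq (h : IsCompression i d A A') (hM : Macaulay m)
    (hM' : Macaulay (m + 1)) (hA : Gotz d A) (j : ℕ) :
    (sliceAt i j (up A')).card = (sliceAt i j (up A)).card := by
  have hN : d + 1 < d + 2 + j := by omega
  have h1 := h.card_up_eq hM hM' hA
  rw [h.homog.up.card_eq_sum i hN, h.homog'.up.card_eq_sum i hN,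
    Finset.sum_eq_sum_iff_of_le fun j _ => h.card_sliceAt_up_le hM j] at h1
  exact h1 j (Finset.mem_range.2 (by omega))

theorem Gotz.sliceAt_zero (hM : Macaulay m) (hM' : Macaulay (m + 1)) (hA : Gotz d A)
    (i : Fin (m + 1)) : Gotz d (sliceAt i 0 A) := by
  refine ⟨hA.1.sliceAt i 0, fun L hL hc => ?_⟩
  obtain ⟨A', h⟩ := exists_isCompression i hA.1
  have h1 := h.card_sliceAt_up_eq hM hM' hA 0
  rw [sliceAt_up_zero, sliceAt_up_zero] at h1
  rw [hL.eq_of_card_eq (h.isSeg 0) (hc.trans (h.card_eq 0).symm), h1]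

/-- The structure of consecutive slices of a set with minimal shadow. -/
theorem Gotz.sliceAt_succ (hM : Macaulay m) (hM' : Macaulay (m + 1)) (hA : Gotz d A)
    (i : Fin (m + 1)) (j : ℕ) :
    up (sliceAt i (j + 1) A) ⊆ sliceAt i j A ∨
      (sliceAt i j A ⊆ up (sliceAt i (j + 1) A) ∧ Gotz (d - (j + 1)) (sliceAt i (j + 1) A)) := by
  obtain ⟨A', h⟩ := exists_isCompression i hA.1
  have h1 := h.card_sliceAt_up_eq hM hM' hA (j + 1)
  rw [sliceAt_up_succ, sliceAt_up_succ] at h1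
  -- The alternatives record which of the two nested segments in the compressed set is larger;
  -- equality of sizes transfers this to an inclusion for `A`.
  rcases (h.isSeg j).total (h.isSeg_up j) with hs | hs
  · right
    rw [Finset.union_eq_right.2 hs] at h1
    have h2 := hM _ _ _ (h.homog.sliceAt i _) (h.isSeg (j + 1)) (h.card_eq _).le
    have h3 := Finset.eq_of_subset_of_card_le
      (Finset.subset_union_right (s₁ := sliceAt i j A) (s₂ := up (sliceAt i (j + 1) A)))
      (by omega)
    refine ⟨Finset.union_eq_right.1 h3.symm, h.homog.sliceAt i _, fun L hL hc => ?_⟩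
    rw [hL.eq_of_card_eq (h.isSeg _) (hc.trans (h.card_eq _).symm), h1]
    exact Finset.card_le_card Finset.subset_union_right
  · left
    rw [Finset.union_eq_left.2 hs, h.card_eq] at h1
    have h3 := Finset.eq_of_subset_of_card_le
      (Finset.subset_union_left (s₁ := sliceAt i j A) (s₂ := up (sliceAt i (j + 1) A)))
      (by omega)
    exact Finset.union_eq_left.1 h3.symm

theorem insertNth_sup (i : Fin (m + 1)) (a b : ℕ) (x y : Fin m → ℕ) :
    (i.insertNth a x : Fin (m + 1) → ℕ) ⊔ i.insertNth b y = i.insertNth (a ⊔ b) (x ⊔ y) := by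
  funext k
  rcases Fin.eq_self_or_eq_succAbove i k with rfl | ⟨l, rfl⟩ <;> simp

theorem joined_of_linConn_sliceAt (hA : Homog d A) {u v τ : Fin (m + 1) → ℕ} (hu : u ∈ A)
    (hv : v ∈ A) (huτ : u ≤ τ) (hvτ : v ≤ τ) (hτ : deg τ ≤ d + 2) (huv : u i = v i)
    (hS : LinConn (d - u i) (sliceAt i (u i) A)) : Joined d A τ u v := by
  have hle : ∀ x : Fin m → ℕ, x ≤ i.removeNth τ →
      (i.insertNth (u i) x : Fin (m + 1) → ℕ) ≤ τ := fun x hx =>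
    Fin.insertNth_le_iff.2 ⟨huτ i, hx⟩
  have hj := hS (i.removeNth τ) (by
      have h1 := deg_eq_add_removeNth i τ
      have h2 : u i ≤ τ i := huτ i
      have h3 := hA u hu
      have h4 := deg_eq_add_removeNth i u
      rw [h3] at h4
      omega) (i.removeNth u) ((removeNth_mem_sliceAt i).2 hu) (i.removeNth v)
    (huv ▸ (removeNth_mem_sliceAt i).2 hv) (fun k => huτ _) (fun k => hvτ _)
  have := Relation.ReflTransGen.lift (p := LinStep d A τ)
    (fun x => (i.insertNth (u i) x : Fin (m + 1) → ℕ)) (by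
      rintro x y ⟨h1, h2, h3, h4, h5⟩
      refine ⟨mem_sliceAt.1 h1, hle x h2, mem_sliceAt.1 h3, hle y h4, ?_⟩
      have := hA.le_of_mem_sliceAt h1
      rw [insertNth_sup, deg_insertNth, sup_idem]
      omega) _ _ hj
  simp only [Function.onFun] at this
  rw [Fin.insertNth_self_removeNth] at this
  rw [huv, Fin.insertNth_self_removeNth] at this
  exact this

/-- If the shadow of a slice lies in the next lower slice, then a unit can be moved from the
entry `i` to any other entry. -/
theorem move_mem {j : ℕ} (h : up (sliceAt i (j + 1) A) ⊆ sliceAt i j A) {w : Fin (m + 1) → ℕ}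
    (hw : w + Pi.single i 1 ∈ A) (hj : w i = j) {k : Fin (m + 1)} (hk : k ≠ i) :
    w + Pi.single k 1 ∈ A := by
  obtain ⟨l, rfl⟩ := Fin.exists_succAbove_eq hk
  subst hj
  rw [← Fin.insertNth_self_removeNth i w, insertNth_add_single_self, ← mem_sliceAt] at hw
  rw [← Fin.insertNth_self_removeNth i w, insertNth_add_single_succAbove, ← mem_sliceAt]
  exact h (add_single_mem_up hw l)

theorem deg_sup_move_le (w : Fin m → ℕ) (i k : Fin m) :
    deg ((w + Pi.single i 1) ⊔ (w + Pi.single k 1)) ≤ deg w + 2 := by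
  have : (w + Pi.single i 1) ⊔ (w + Pi.single k 1) ≤ w + Pi.single i 1 + Pi.single k 1 := by
    refine sup_le (by simp) ?_
    rw [add_right_comm]
    simp
  have := deg_mono this
  rwa [deg_add_single, deg_add_single] at this

theorem add_single_sup (w w' : Fin m → ℕ) (i : Fin m) :
    (w + Pi.single i 1) ⊔ (w' + Pi.single i 1) = w ⊔ w' + Pi.single i 1 := by
  funext k
  simp only [Pi.sup_apply, Pi.add_apply]
  omega

/-- If the common slice has minimal shadow, the path runs inside it. Otherwise units may be moved
away from the entry `i`. Writing `u = w + e_i` and `v = w' + e_i`, the path goes through `w + e_k`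
and `w' + e_l`, with `k` and `l` chosen so that both lie below `w ⊔ w'`. The latter has degree at
most `d + 1`, because `w ⊔ w' + e_i ≤ τ`. -/
theorem joined_of_common (hM : Macaulay m) (hM' : Macaulay (m + 1))
    (hG : ∀ (e : ℕ) (B : Finset (Fin m → ℕ)), Gotz e B → LinConn e B) (hA : Gotz d A)
    {u v τ : Fin (m + 1) → ℕ} (hu : u ∈ A) (hv : v ∈ A) (huτ : u ≤ τ) (hvτ : v ≤ τ)
    (hτ : deg τ ≤ d + 2) (huv : u i = v i) : Joined d A τ u v := by
  rcases eq_or_ne u v with rfl | hne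
  · exact Relation.ReflTransGen.refl
  have hslice : Gotz (d - u i) (sliceAt i (u i) A) → Joined d A τ u v := fun h =>
    joined_of_linConn_sliceAt hA.1 hu hv huτ hvτ hτ huv (hG _ _ h)
  rcases Nat.eq_zero_or_pos (u i) with h0 | hpos
  · exact hslice (h0 ▸ hA.sliceAt_zero hM hM' i)
  obtain ⟨w, rfl⟩ := exists_eq_add_single hpos
  obtain ⟨w', rfl⟩ := exists_eq_add_single (i := i) (u := v) (by omega)
  have hwi : (w + Pi.single i 1 : Fin (m + 1) → ℕ) i = w i + 1 := by simp
  have hww : w i = w' i := by simpa using huv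
  rcases hA.sliceAt_succ hM hM' i (w i) with hP | hQ
  · have hd := hA.1 _ hu
    have hd' := hA.1 _ hv
    rw [deg_add_single] at hd hd'
    have hne' : w ≠ w' := fun h => hne (h ▸ rfl)
    obtain ⟨k, hk⟩ := exists_lt_of_ne (by omega) hne'
    obtain ⟨l, hl⟩ := exists_lt_of_ne (by omega) hne'.symm
    have hki : k ≠ i := fun h => by subst h; omega
    have hli : l ≠ i := fun h => by subst h; omega
    have hx := move_mem hP hu rfl hki
    have hy := move_mem hP hv hww.symm hli
    have hle : w ⊔ w' + Pi.single i 1 ≤ τ := by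
      rw [← add_single_sup]; exact sup_le huτ hvτ
    have hle' : w ⊔ w' ≤ τ := le_trans (by simp) hle
    have hxw : w + Pi.single k 1 ≤ w ⊔ w' := add_single_le le_sup_left (by simpa using hk)
    have hyw : w' + Pi.single l 1 ≤ w ⊔ w' := add_single_le le_sup_right (by simpa using hl)
    have h1 := deg_sup_move_le w i k
    have h2 := deg_sup_move_le w' l i
    have h3 := deg_mono (sup_le hxw hyw)
    have h4 := deg_mono hle
    rw [deg_add_single] at h4
    refine Relation.ReflTransGen.head (b := w + Pi.single k 1) ?_
      (Relation.ReflTransGen.head (b := w' + Pi.single l 1) ?_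
        (Relation.ReflTransGen.single ?_))
    · exact ⟨hu, huτ, hx, hxw.trans hle', by omega⟩
    · exact ⟨hx, hxw.trans hle', hy, hyw.trans hle', by omega⟩
    · exact ⟨hy, hyw.trans hle', hv, hvτ, by omega⟩
  · exact hslice (hwi ▸ hQ.2)

/-- One of two detours works. If units can be moved out of the slice of `v`, a neighbour `w + e_k`
of `v` satisfies `u ⊔ (w + e_k) ≤ τ`, strictly in the entry `i`. Otherwise `u` has a neighbour `x +
e_i` in the slice of `v`, and that slice has minimal shadow. -/
theorem joined_of_succ (hM : Macaulay m) (hM' : Macaulay (m + 1))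
    (hG : ∀ (e : ℕ) (B : Finset (Fin m → ℕ)), Gotz e B → LinConn e B) (hA : Gotz d A)
    {u v τ : Fin (m + 1) → ℕ} (hu : u ∈ A) (hv : v ∈ A) (huτ : u ≤ τ) (hvτ : v ≤ τ)
    (hτ : deg τ ≤ d + 2) (huv : v i = u i + 1) : Joined d A τ u v := by
  obtain ⟨w, rfl⟩ := exists_eq_add_single (i := i) (u := v) (by omega)
  have hwi : w i = u i := by simpa using huv
  have hud := hA.1 u hu
  have hd := hA.1 _ hv
  rw [deg_add_single] at hd
  rcases hA.sliceAt_succ hM hM' i (u i) with hP | hQ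
  · obtain ⟨k, hk⟩ := exists_lt_of_ne (u := w + Pi.single i 1) (v := u)
      (by rw [deg_add_single, hd, hud]) (fun h => by rw [h] at huv; omega)
    have hki : k ≠ i := fun h => by subst h; omega
    have hwk : w k < u k := by simpa [Pi.single_eq_of_ne hki] using hk
    have hy := move_mem hP hv hwi hki
    have hyτ : w + Pi.single k 1 ≤ τ :=
      add_single_le (le_trans (by simp) hvτ) (hwk.trans_le (huτ k))
    have hlt : (u ⊔ (w + Pi.single k 1)) i < τ i := by
      have h0 : (w + Pi.single i 1 : Fin (m + 1) → ℕ) i ≤ τ i := hvτ i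
      have h0' : u i ≤ τ i := huτ i
      rw [huv] at h0
      simp only [Pi.sup_apply, Pi.add_apply, Pi.single_eq_of_ne hki.symm]
      omega
    have h1 := deg_mono (add_single_le (sup_le huτ hyτ) hlt)
    rw [deg_add_single] at h1
    have h2 := deg_sup_move_le w k i
    exact Relation.ReflTransGen.head (b := w + Pi.single k 1)
      ⟨hu, huτ, hy, hyτ, by omega⟩ (Relation.ReflTransGen.single ⟨hy, hyτ, hv, hvτ, by omega⟩)
  · obtain ⟨y, hy, k, hk⟩ := mem_up.1 (hQ.1 ((removeNth_mem_sliceAt i).2 hu))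
    rw [mem_sliceAt, ← insertNth_add_single_self] at hy
    set x : Fin (m + 1) → ℕ := i.insertNth (u i) y with hx
    have hxi : x i = u i := by simp [hx]
    have hux : u = x + Pi.single (i.succAbove k) 1 := by
      rw [hx, insertNth_add_single_succAbove, hk, Fin.insertNth_self_removeNth]
    have hxτ : x ≤ τ := le_trans (by rw [hux]; simp) huτ
    have hyτ : x + Pi.single i 1 ≤ τ := by
      refine add_single_le hxτ ?_
      have : (w + Pi.single i 1 : Fin (m + 1) → ℕ) i ≤ τ i := hvτ i
      omega
    have h2 := deg_sup_move_le x (i.succAbove k) i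
    rw [← hux] at h2
    have h3 : deg x + 1 = d := by rw [← hud, hux, deg_add_single]
    have hyi : (x + Pi.single i 1 : Fin (m + 1) → ℕ) i = u i + 1 := by simp [hxi]
    refine Relation.ReflTransGen.head (b := x + Pi.single i 1)
      ⟨hu, huτ, hy, hyτ, by omega⟩ (joined_of_linConn_sliceAt (i := i) hA.1 hy hv hyτ hvτ hτ
        (hyi.trans huv.symm) ?_)
    rw [hyi]
    exact hG _ _ hQ.2

/-- Linear connectedness passes from `m` to `m + 1` variables. -/
theorem Gotz.linConn_succ (hm : 2 ≤ m) (hM : Macaulay m) (hM' : Macaulay (m + 1))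
    (hG : ∀ (e : ℕ) (B : Finset (Fin m → ℕ)), Gotz e B → LinConn e B) (hA : Gotz d A) :
    LinConn d A := by
  intro τ hτ u hu v hv huτ hvτ
  by_cases hc : ∃ i, u i = v i ∨ v i = u i + 1 ∨ u i = v i + 1
  · obtain ⟨i, h | h | h⟩ := hc
    · exact joined_of_common hM hM' hG hA hu hv huτ hvτ hτ h
    · exact joined_of_succ hM hM' hG hA hu hv huτ hvτ hτ h
    · exact (joined_of_succ hM hM' hG hA hv hu hvτ huτ hτ h).symm
  · exfalso
    push Not at hc
    -- If `u` and `v` differ by at least `2` in each of the `m + 1 ≥ 3` entries, then `u ⊔ v` has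
    -- degree at least `d + 3`, too large to lie below `τ`.
    have h1 : deg u + deg v + 2 * (m + 1) ≤ 2 * deg (u ⊔ v) := by
      have : ∑ i : Fin (m + 1), (u i + v i + 2) ≤ ∑ i, 2 * (u ⊔ v) i := by
        refine Finset.sum_le_sum fun i _ => ?_
        have := hc i
        simp only [Pi.sup_apply]
        omega
      rw [← Finset.mul_sum, Finset.sum_add_distrib, Finset.sum_add_distrib] at this
      simp at this
      simp only [deg, Pi.sup_apply]
      omega
    have h2 := deg_mono (sup_le huτ hvτ)
    rw [hA.1 u hu, hA.1 v hv] at h1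
    omega

end Slices

/-! ### Persistence -/

/-- Take `τ` to be `w` with entry `j + 2` inserted. A step from level `j` below `τ` reaches level `j
+ 1` at most, and reaching that level would put `w` into the excluded shadow. So the starting point
is isolated below `τ`, although `h2` supplies another member there at level `j + 2`. -/
theorem not_linConn_of_isolated {m d : ℕ} {i : Fin (m + 1)} {A : Finset (Fin (m + 1) → ℕ)}
    (hA : Homog d A) {j : ℕ} {w : Fin m → ℕ} (h0 : w ∈ sliceAt i j A)
    (h1 : w ∉ up (sliceAt i (j + 1) A)) (h2 : w ∈ up (up (sliceAt i (j + 2) A))) :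
    ¬ LinConn d A := by
  intro hL
  obtain ⟨y', hy', k, rfl⟩ := mem_up.1 h2
  obtain ⟨y, hy, l, rfl⟩ := mem_up.1 hy'
  set w := y + Pi.single l 1 + Pi.single k 1 with hw
  have hyw : y ≤ w := by rw [hw, add_assoc]; simp
  have hwd := hA.le_of_mem_sliceAt h0
  have hj := hL (i.insertNth (j + 2) w) (by rw [deg_insertNth]; omega) _ (mem_sliceAt.1 h0) _
    (mem_sliceAt.1 hy) (by rw [Fin.insertNth_le_iff]; simp)
    (by rw [Fin.insertNth_le_iff]; exact ⟨by simp, fun k => by simpa using hyw k⟩)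
  have key : ∀ z, Joined d A (i.insertNth (j + 2) w) (i.insertNth j w) z →
      z = i.insertNth j w := by
    intro z hz
    induction hz with
    | refl => rfl
    | @tail b z _ hstep ih =>
      subst ih
      obtain ⟨-, -, hzA, hzτ, hdeg⟩ := hstep
      obtain ⟨s, x, rfl⟩ : ∃ s x, z = (i.insertNth s x : Fin (m + 1) → ℕ) :=
        ⟨z i, i.removeNth z, (Fin.insertNth_self_removeNth i z).symm⟩
      have hx := hA.le_of_mem_sliceAt (mem_sliceAt.2 hzA)
      rw [Fin.insertNth_le_iff] at hzτ
      have hs : s ≤ j + 2 := by simpa using hzτ.1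
      have hxw : x ≤ w := fun k => by simpa using hzτ.2 k
      have hdx := deg_mono hxw
      rw [insertNth_sup, deg_insertNth, sup_eq_left.2 hxw] at hdeg
      have hsj : s = j ∨ s = j + 1 := by omega
      rcases hsj with rfl | rfl
      · rw [eq_of_le_of_deg_le hxw (by omega)]
      · refine absurd ((hA.sliceAt i (j + 1)).mem_up_iff.2 ⟨?_, x, mem_sliceAt.2 hzA, hxw⟩) h1
        omega
  have := (Fin.insertNth_injective2 (key _ hj)).1
  omega

/-- Linear connectedness and persistence for sets with minimal shadow. -/
def Persistence (m : ℕ) : Prop :=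
  ∀ (d : ℕ) (A : Finset (Fin m → ℕ)), Gotz d A → LinConn d A ∧ Gotz (d + 1) (up A)

section Persist

variable {m d : ℕ} {i : Fin (m + 1)} {A A' : Finset (Fin (m + 1) → ℕ)}

/-- By `LastStable.card_up`, minimality forces `A` and the segment of the same size to have the same
slice with last entry `0`: a proper inclusion of segments would enlarge the shadow strictly. The
same formula then equates the sizes of the second shadows. -/
theorem gotz_up_of_compressed (hm : 2 ≤ m) (hc : ∀ i, Compressed i d A) (hA : Gotz d A) :
    Gotz (d + 1) (up A) := by
  refine ⟨hA.1.up, fun L' hL' hcard' => ?_⟩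
  have hM' := macaulay_of_two_le (m := m + 1) (by omega)
  obtain ⟨L, hL, hcard⟩ := hA.1.exists_isSeg_card_eq
  have hup := hA.card_up_eq hM' hL hcard
  rw [hL'.eq_of_card_eq hL.up (hcard'.trans hup)]
  have hsA := lastStable_of_compressed hm hA.1 hc
  have hsL := lastStable_of_compressed hm hL.1 hL.compressed
  have hsub := sliceAt_last_zero_subset hm hA.1 hc hL hcard.le
  have heq : sliceAt (Fin.last m) 0 L = sliceAt (Fin.last m) 0 A := by
    refine Finset.eq_of_subset_of_card_le hsub ?_
    have h1 := hsA.card_up hA.1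
    have h2 := hsL.card_up hL.1
    obtain ⟨m, rfl⟩ : ∃ k, m = k + 1 := ⟨m - 1, by omega⟩
    have h3 := (hL.sliceAt (Fin.last _) 0).card_up_add_le (hc (Fin.last _) 0)
      (Nat.add_sub_cancel' (Finset.card_le_card hsub)).le
    omega
  rw [hsA.up.card_up hA.1.up, hsL.up.card_up hL.1.up, sliceAt_up_zero, sliceAt_up_zero, heq, hup]

/-- The vector with entry `j + 1` and remainder `z` can be adjoined to `A'` without enlarging its
shadow, contradicting Macaulay with surplus `1`. -/
theorem IsCompression.false_of_room (h : IsCompression i d A A') (hM' : Macaulay (m + 1))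
    (hA' : Gotz d A') {j : ℕ} {z : Fin m → ℕ} (hz : z ∈ up (sliceAt i (j + 2) A'))
    (hz' : z ∉ sliceAt i (j + 1) A')
    (hsub : up (up (sliceAt i (j + 2) A')) ⊆ sliceAt i j A') : False := by
  set x : Fin (m + 1) → ℕ := i.insertNth (j + 1) z with hx
  have hxA : x ∉ A' := fun h => hz' (mem_sliceAt.2 h)
  have hxd : deg x = d := by
    obtain ⟨y, hy, k, rfl⟩ := mem_up.1 hz
    have := h.homog'.le_of_mem_sliceAt hy
    rw [hx, deg_insertNth, deg_add_single]
    omega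
  have hhom : Homog d (insert x A') := by
    intro u hu
    rcases Finset.mem_insert.1 hu with rfl | hu
    · exact hxd
    · exact h.homog' u hu
  have hup : up (insert x A') ⊆ up A' := by
    intro v hv
    obtain ⟨u, hu, k, rfl⟩ := mem_up.1 hv
    rcases Finset.mem_insert.1 hu with rfl | hu
    · rcases Fin.eq_self_or_eq_succAbove i k with rfl | ⟨l, rfl⟩
      · rw [hx, insertNth_add_single_self, ← mem_sliceAt, sliceAt_up_succ]
        exact Finset.mem_union_right _ hz
      · rw [hx, insertNth_add_single_succAbove, ← mem_sliceAt, sliceAt_up_succ]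
        exact Finset.mem_union_left _ (hsub (add_single_mem_up hz l))
    · exact add_single_mem_up hu k
  obtain ⟨L, hL, hcard⟩ := h.homog'.exists_isSeg_card_eq
  have h1 := hM'.card_add_le (c := 1) hhom hL
    (by rw [Finset.card_insert_of_notMem hxA, hcard])
  have h2 := hA'.2 L hL hcard
  have h3 := Finset.card_le_card hup
  omega

/-- The core of persistence. If slice `j` contains the shadow of slice `j + 1`, then slice `j + 1`
of the second shadow is slice `j` of the first, whose size is preserved. Otherwise slice `j + 1` has
minimal shadow and its second shadow is the whole slice (`hsub`), which persistence in `m` variables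
controls. -/
theorem IsCompression.card_sliceAt_up_up_le (hm : 2 ≤ m) (h : IsCompression i d A A')
    (hP : Persistence m) (hA : Gotz d A) (j : ℕ) :
    (sliceAt i j (up (up A))).card ≤ (sliceAt i j (up (up A'))).card := by
  have hM := macaulay_of_two_le hm
  have hM' := macaulay_of_two_le (m := m + 1) (by omega)
  have hA' := h.gotz hM hA
  have hB := h.card_sliceAt_up_eq hM hM' hA
  have hconn : LinConn d A' := hA'.linConn_succ hm hM hM' fun e B hB => (hP e B hB).1
  have hgot : ∀ j, Gotz (d - j) (sliceAt i j A) →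
      (up (up (sliceAt i j A))).card ≤ (up (up (sliceAt i j A'))).card ∧
        (up (sliceAt i j A)).card = (up (sliceAt i j A')).card := by
    intro j hj
    have h1 := hj.card_up_eq hM (h.isSeg j) (h.card_eq j)
    exact ⟨(hP _ _ hj).2.2 _ (h.isSeg j).up h1.symm, h1⟩
  cases j with
  | zero =>
    simp only [sliceAt_up_zero]
    exact (hgot 0 (hA.sliceAt_zero hM hM' i)).1
  | succ j =>
    by_cases hPj : up (sliceAt i (j + 1) A) ⊆ sliceAt i j A
    · rw [sliceAt_up_succ, sliceAt_up_succ i j A, Finset.union_eq_left.2 hPj,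
        Finset.union_eq_left.2 (up_sliceAt_subset i j A), ← hB, sliceAt_up_succ]
      exact Finset.card_le_card Finset.subset_union_left
    · obtain ⟨hQ, hGj⟩ := (hA.sliceAt_succ hM hM' i j).resolve_left hPj
      obtain ⟨hg1, hg2⟩ := hgot _ hGj
      have hsub : sliceAt i j (up A) ⊆ up (up (sliceAt i (j + 1) A)) := by
        cases j with
        | zero => rw [sliceAt_up_zero]; exact up_mono hQ
        | succ j =>
          rw [sliceAt_up_succ]
          refine Finset.union_subset ?_ (up_mono hQ)
          rcases hA.sliceAt_succ hM hM' i j with hP' | hQ'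
          · by_cases hc : (sliceAt i j A').card ≤ (up (sliceAt i (j + 1) A')).card
            · have h1 := hM _ _ _ (h.homog.sliceAt i _) (h.isSeg (j + 1)) (h.card_eq _).le
              have h2 := h.card_eq j
              rw [← Finset.eq_of_subset_of_card_le hP' (by omega)]
              exact up_mono hQ
            -- A surplus in slice `j` of `A'` gives a vector `w`, and the properness of `hQ` gives a
            -- free place `z` in slice `j + 1`. By comparability of segments, either `w` is
            -- isolated, against connectedness, or `z` can be filled in, against minimality.
            · exfalso
              obtain ⟨w, hw, hw'⟩ :=
                Finset.exists_mem_notMem_of_card_lt_card (not_le.1 hc)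
              have hlt : (sliceAt i (j + 1) A').card < (up (sliceAt i (j + 2) A')).card := by
                rw [h.card_eq, ← hg2]
                exact Finset.card_lt_card ⟨hQ, hPj⟩
              obtain ⟨z, hz, hz'⟩ := Finset.exists_mem_notMem_of_card_lt_card hlt
              -- This excludes truncation, so that the segments compared have the same degree.
              have hjd : j + 2 ≤ d := by
                obtain ⟨y, hy, -⟩ := mem_up.1 hz
                have := h.homog'.le_of_mem_sliceAt hy
                omega
              have hseg := (h.isSeg (j + 2)).up.up
              rw [show d - (j + 2) + 1 + 1 = d - j by omega] at hseg
              rcases (h.isSeg j).total hseg with hs | hs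
              · exact not_linConn_of_isolated h.homog' hw hw' (hs hw) hconn
              · exact h.false_of_room hM' hA' hz hz' hs
          · exact hQ'.1.trans (up_mono hQ)
      rw [sliceAt_up_succ, sliceAt_up_succ i j A, Finset.union_eq_right.2 hQ,
        Finset.union_eq_right.2 hsub, sliceAt_up_succ]
      refine hg1.trans (Finset.card_le_card (Finset.Subset.trans (up_mono ?_)
        Finset.subset_union_right))
      rw [sliceAt_up_succ]
      exact Finset.subset_union_right

theorem persistence_succ (hm : 2 ≤ m) (hP : Persistence m) : Persistence (m + 1) := by
  have hM := macaulay_of_two_le hm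
  have hM' := macaulay_of_two_le (m := m + 1) (by omega)
  intro d A hA
  refine ⟨hA.linConn_succ hm hM hM' fun e B hB => (hP e B hB).1, ?_⟩
  refine compression_induction (P := fun A => Gotz d A → Gotz (d + 1) (up A))
    (fun A _ hc hA => gotz_up_of_compressed hm hc hA) ?_ A hA.1 hA
  intro A A' i h ih hA
  refine ⟨hA.1.up, fun L hL hcard => ?_⟩
  refine le_trans ?_ ((ih (h.gotz hM hA)).2 L hL (hcard.trans (h.card_up_eq hM hM' hA).symm))
  rw [h.homog.up.up.card_eq_sum i (Nat.lt_succ_self _),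
    h.homog'.up.up.card_eq_sum i (Nat.lt_succ_self _)]
  exact Finset.sum_le_sum fun j _ => h.card_sliceAt_up_up_le hm hP hA j

end Persist

/-! ### Persistence in two variables and in general -/

theorem Gotz.up_eq_shiftInsert {d : ℕ} {A : Finset (Fin 2 → ℕ)} (h : Gotz d A)
    {v : Fin 2 → ℕ} (hv : v ∈ A) (hmin : ∀ u ∈ A, v 0 ≤ u 0) : up A = shiftInsert A v := by
  refine (Finset.eq_of_subset_of_card_le (shiftInsert_subset hv) ?_).symm
  obtain ⟨L, hL, hc⟩ := h.1.exists_isSeg_card_eq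
  have hne : L.Nonempty := by
    rw [← Finset.card_pos, hc]
    exact Finset.card_pos.2 ⟨v, hv⟩
  rw [card_shiftInsert hmin, ← hc, ← hL.card_up_two hne]
  exact h.2 L hL hc

theorem persistence_two : Persistence 2 := by
  intro d A hA
  rcases A.eq_empty_or_nonempty with rfl | hne
  · refine ⟨fun τ _ u hu => by simp at hu, hA.1.up, fun L _ _ => by simp [up]⟩
  obtain ⟨v, hv, hmin⟩ := exists_min_zero hne
  have hup := hA.up_eq_shiftInsert hv hmin
  constructor
  · have key : ∀ τ, deg τ ≤ d + 2 → ∀ u ∈ A, ∀ u' ∈ A, u ≤ τ → u' ≤ τ → u 0 < u' 0 →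
        Joined d A τ u u' := by
      intro τ hτ u hu u' hu' huτ huτ' hlt
      have hud := hA.1 u hu
      have hud' := hA.1 u' hu'
      have hvu := hmin u hu
      obtain ⟨w, rfl⟩ := exists_eq_add_single (i := 0) (u := u') (by omega)
      have hw0 : (w + Pi.single 0 1 : Fin 2 → ℕ) 0 = w 0 + 1 := by simp
      -- The shadow is no larger than `shiftInsert A v`. As `u'` is not the minimal vector `v`, its
      -- multiple by the second variable must be a multiple by the first variable of a member of
      -- `A`, namely of `w + e_1`.
      have hw : w + Pi.single 1 1 ∈ A := by
        have hmem : w + Pi.single 0 1 + Pi.single 1 1 ∈ shiftInsert A v :=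
          hup ▸ add_single_mem_up hu' 1
        rcases Finset.mem_insert.1 hmem with he | he
        · have := congrFun (add_right_cancel he) 0
          omega
        · obtain ⟨y, hy, he⟩ := Finset.mem_image.1 he
          rw [add_right_comm] at he
          exact add_right_cancel he ▸ hy
      rw [deg_add_single] at hud'
      have h2 := deg_sup_move_le w 1 0
      have hu1 : w 1 < u 1 := by
        simp only [deg, Fin.sum_univ_two] at hud hud'
        omega
      have hyτ : w + Pi.single 1 1 ≤ τ :=
        add_single_le (le_trans (by simp) huτ') (hu1.trans_le (huτ 1))
      have h3 : (u ⊔ (w + Pi.single 1 1)) 0 < τ 0 := by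
        have h5 : (w + Pi.single 0 1 : Fin 2 → ℕ) 0 ≤ τ 0 := huτ' 0
        have h6 : (w + Pi.single 1 1 : Fin 2 → ℕ) 0 = w 0 := by simp
        rw [hw0] at h5 hlt
        rw [Pi.sup_apply, h6]
        omega
      have h4 := deg_mono (add_single_le (sup_le huτ hyτ) h3)
      rw [deg_add_single] at h4
      exact Relation.ReflTransGen.head (b := w + Pi.single 1 1)
        ⟨hu, huτ, hw, hyτ, by omega⟩
        (Relation.ReflTransGen.single ⟨hw, hyτ, hu', huτ', by omega⟩)
    intro τ hτ u hu u' hu' huτ huτ'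
    rcases lt_trichotomy (u 0) (u' 0) with h | h | h
    · exact key τ hτ u hu u' hu' huτ huτ' h
    · rw [eq_of_zero_eq ((hA.1 u hu).trans (hA.1 u' hu').symm) h]
      exact Relation.ReflTransGen.refl
    · exact (key τ hτ u' hu' u hu huτ' huτ h).symm
  · refine ⟨hA.1.up, fun L hL hc => ?_⟩
    have hneL : L.Nonempty := by
      rw [← Finset.card_pos, hc]
      exact Finset.card_pos.2 ⟨_, add_single_mem_up hv 0⟩
    rw [hL.card_up_two hneL, hc]
    have hsub : up (up A) ⊆ shiftInsert (up A) (v + Pi.single 1 1) := by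
      intro x hx
      obtain ⟨z, hz, k, rfl⟩ := mem_up.1 hx
      rw [shiftInsert, Finset.mem_insert, Finset.mem_image]
      fin_cases k
      · exact Or.inr ⟨z, hz, rfl⟩
      · rw [hup] at hz
        rcases Finset.mem_insert.1 hz with rfl | hz
        · exact Or.inl rfl
        · obtain ⟨y, hy, rfl⟩ := Finset.mem_image.1 hz
          exact Or.inr ⟨y + Pi.single 1 1, add_single_mem_up hy 1, add_right_comm _ _ _⟩
    refine (Finset.card_le_card hsub).trans ((Finset.card_insert_le _ _).trans ?_)
    rw [Finset.card_image_of_injective _ (add_left_injective _)]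

theorem persistence {m : ℕ} (hm : 2 ≤ m) : Persistence m := by
  induction m, hm using Nat.le_induction with
  | base => exact persistence_two
  | succ m hm ih => exact persistence_succ hm ih

/-- Members of a set with minimal shadow which lie below `τ` are connected below `τ`. -/
theorem Gotz.joined {m d : ℕ} (hm : 2 ≤ m) {A : Finset (Fin m → ℕ)} (hA : Gotz d A) :
    ∀ (τ : Fin m → ℕ), ∀ u ∈ A, ∀ v ∈ A, u ≤ τ → v ≤ τ → Joined d A τ u v := by
  have hiter : ∀ k, Gotz (d + k) (up^[k] A) := by
    intro k
    induction k with
    | zero => exact hA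
    | succ k ih =>
      rw [Function.iterate_succ_apply']
      exact (persistence hm _ _ ih).2
  have hmem : ∀ k v, v ∈ up^[k] A ↔ deg v = d + k ∧ ∃ u ∈ A, u ≤ v := by
    intro k
    induction k with
    | zero =>
      intro v
      constructor
      · exact fun hv => ⟨hA.1 v hv, v, hv, le_rfl⟩
      · rintro ⟨hd, u, hu, hle⟩
        have := eq_of_le_of_deg_le hle (by rw [hd, hA.1 u hu]; exact le_rfl)
        exact this ▸ hu
    | succ k ih =>
      intro v
      rw [Function.iterate_succ_apply', (hiter k).1.mem_up_iff]
      constructor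
      · rintro ⟨hd, w, hw, hle⟩
        obtain ⟨-, u, hu, huw⟩ := (ih w).1 hw
        exact ⟨hd, u, hu, huw.trans hle⟩
      · rintro ⟨hd, u, hu, hle⟩
        obtain ⟨w, h1, h2, h3⟩ := exists_between hle (e := d + k)
          (by rw [hA.1 u hu]; omega) (by omega)
        exact ⟨hd, w, (ih w).2 ⟨h3, u, hu, h1⟩, h2⟩
  intro τ
  induction hn : deg τ using Nat.strong_induction_on generalizing τ with
  | _ n ih =>
    subst hn
    intro u hu v hv huτ hvτ
    have hmono : ∀ σ ≤ τ, ∀ x y, Joined d A σ x y → Joined d A τ x y := fun σ hσ x y h =>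
      Relation.ReflTransGen.mono (fun a b h => ⟨h.1, h.2.1.trans hσ, h.2.2.1, h.2.2.2.1.trans hσ, h.2.2.2.2⟩) _ _ h
    by_cases hle : deg τ ≤ d + 2
    · exact (persistence hm d A hA).1 τ hle u hu v hv huτ hvτ
    -- For larger `τ`, apply connectedness to the multiples of degree `d + k`. Each step between `b`
    -- and `c` there has `deg (b ⊔ c) < deg τ`, so the members of `A` below `b` and `c` are joined
    -- by the induction hypothesis for `b ⊔ c`.
    obtain ⟨k, hk⟩ : ∃ k, deg τ = d + k + 2 := ⟨deg τ - 2 - d, by omega⟩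
    have hud := hA.1 u hu
    have hvd := hA.1 v hv
    obtain ⟨x, hx1, hx2, hx3⟩ := exists_between huτ (e := d + k) (by omega) (by omega)
    obtain ⟨y, hy1, hy2, hy3⟩ := exists_between hvτ (e := d + k) (by omega) (by omega)
    have hxy := (persistence hm _ _ (hiter k)).1 τ hk.le x ((hmem k x).2 ⟨hx3, u, hu, hx1⟩) y
      ((hmem k y).2 ⟨hy3, v, hv, hy1⟩) hx2 hy2
    have key : ∀ z, Joined (d + k) (up^[k] A) τ x z → ∀ a ∈ A, a ≤ z → Joined d A τ u a := by
      intro z hz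
      induction hz with
      | refl =>
        intro a ha hax
        exact hmono x hx2 _ _ (ih (deg x) (by omega) x rfl u hu a ha hx1 hax)
      | tail _ hstep ih' =>
        rename_i b c _
        intro a ha hac
        obtain ⟨hb, hbτ, -, hcτ, hdeg⟩ := hstep
        obtain ⟨-, a', ha', hle'⟩ := (hmem k b).1 hb
        refine (ih' a' ha' hle').trans (hmono (b ⊔ c) (sup_le hbτ hcτ) _ _ ?_)
        exact ih (deg (b ⊔ c)) (by omega) _ rfl a' ha' a ha (hle'.trans le_sup_left)
          (hac.trans le_sup_right)
    exact key y hxy v hv hy1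

/-! ### Lexicographic antichains -/

/-- This turns the iteration of runs in one variable fewer into the next level of `ack`. -/
theorem ack_succ_eq_iterate (k b : ℕ) : ack (k + 1) b = (ack k)^[b + 1] 1 := by
  induction b with
  | zero => simp
  | succ b ih => rw [ack_succ_succ, ih, Function.iterate_succ_apply' _ (b + 1)]

/-- Lying above a member of `Z` or above one of `w s, …, w (n - 1)`. -/
def Gen {m : ℕ} (Z : Set (Fin m → ℕ)) (w : ℕ → Fin m → ℕ) (s n : ℕ) (v : Fin m → ℕ) : Prop :=
  (∃ z ∈ Z, z ≤ v) ∨ ∃ e, s ≤ e ∧ e < n ∧ w e ≤ v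

/-- The sequence `w s, …, w (n - 1)` has one member in each degree, each of which is new with
respect to `Z` and the previous ones, such that the multiples form a lexicographic segment in
each degree. In large degrees the multiples are the vectors with first entry at least `j`. -/
structure LexStage {m : ℕ} (Z : Set (Fin (m + 1) → ℕ)) (s n j : ℕ) (w : ℕ → Fin (m + 1) → ℕ) :
    Prop where
  deg_eq : ∀ e, s ≤ e → e < n → deg (w e) = e
  not_gen : ∀ e, s ≤ e → e < n → ¬ Gen Z w s e (w e)
  seg : ∀ e, s ≤ e → e < n → ∀ u v, deg u = e → deg v = e → Gen Z w s (e + 1) v →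
    toLex v < toLex u → Gen Z w s (e + 1) u
  top : ∀ v, n ≤ deg v + 1 → (Gen Z w s n v ↔ j ≤ v 0)

theorem deg_cons {m : ℕ} (j : ℕ) (v : Fin m → ℕ) :
    deg (Fin.cons j v : Fin (m + 1) → ℕ) = j + deg v := by
  simp [deg, Fin.sum_univ_succ]

theorem deg_eq_add_tail {m : ℕ} (u : Fin (m + 1) → ℕ) : deg u = u 0 + deg (Fin.tail u) := by
  simp [deg, Fin.sum_univ_succ, Fin.tail]

theorem lex_tail {m : ℕ} {u v : Fin (m + 1) → ℕ} (h : toLex v < toLex u) :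
    v 0 < u 0 ∨ (u 0 = v 0 ∧ toLex (Fin.tail v) < toLex (Fin.tail u)) := by
  obtain ⟨k, h1, h2⟩ := lex_lt_iff.1 h
  rcases Fin.eq_zero_or_eq_succ k with rfl | ⟨k, rfl⟩
  · exact Or.inl h2
  · exact Or.inr ⟨(h1 0 (Fin.succ_pos k)).symm,
      lex_lt_iff.2 ⟨k, fun j hj => h1 j.succ (Fin.succ_lt_succ_iff.2 hj), h2⟩⟩

/-- From degree `n - 1` on, exactly the vectors with first entry above `j` are covered. Those with
first entry `j` are then covered by a run in the remaining variables, prefixed by `j`, which shifts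
its degrees by `j`. -/
theorem LexStage.extend {m : ℕ} {Z : Set (Fin (m + 2) → ℕ)} {s n j n' : ℕ}
    {w : ℕ → Fin (m + 2) → ℕ} {w' : ℕ → Fin (m + 1) → ℕ} (h : LexStage Z s n (j + 1) w)
    (hsn : s ≤ n) (hj : j + 1 ≤ n) (h' : LexStage ∅ (n - j) n' 0 w') (hn' : n - j ≤ n') :
    LexStage Z s (n' + j) j fun e => if e < n then w e else Fin.cons j (w' (e - j)) := by
  set W : ℕ → Fin (m + 2) → ℕ := fun e => if e < n then w e else Fin.cons j (w' (e - j)) with hW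
  have hWlt : ∀ e, e < n → W e = w e := fun e he => by simp [hW, he]
  have hWge : ∀ e, n ≤ e → W e = Fin.cons j (w' (e - j)) := fun e he => by
    simp [hW, not_lt.2 he]
  have hlow : ∀ e ≤ n, ∀ v, Gen Z W s e v ↔ Gen Z w s e v := by
    intro e he v
    unfold Gen
    refine or_congr Iff.rfl (exists_congr fun e' => ?_)
    constructor
    · rintro ⟨h1, h2, h3⟩
      exact ⟨h1, h2, hWlt e' (by omega) ▸ h3⟩
    · rintro ⟨h1, h2, h3⟩
      exact ⟨h1, h2, (hWlt e' (by omega)).symm ▸ h3⟩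
  have hhigh : ∀ e, n ≤ e → ∀ v, n ≤ deg v + 1 →
      (Gen Z W s e v ↔ j + 1 ≤ v 0 ∨ (v 0 = j ∧ Gen ∅ w' (n - j) (e - j) (Fin.tail v))) := by
    intro e he v hv
    constructor
    · intro hg
      by_cases hv0 : j + 1 ≤ v 0
      · exact Or.inl hv0
      have hold : ¬ Gen Z w s n v := fun hc => hv0 ((h.top v hv).1 hc)
      rcases hg with hz | ⟨e', h1, h2, h3⟩
      · exact absurd (Or.inl hz) hold
      · by_cases he' : e' < n
        · exact absurd (Or.inr ⟨e', h1, he', hWlt e' he' ▸ h3⟩) hold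
        · rw [hWge e' (by omega), Fin.cons_le] at h3
          exact Or.inr ⟨le_antisymm (by omega) h3.1,
            Or.inr ⟨e' - j, by omega, by omega, h3.2⟩⟩
    · rintro (hv0 | ⟨hv0, hz | ⟨e', h1, h2, h3⟩⟩)
      · rcases (h.top v hv).2 hv0 with hz | ⟨e', h1, h2, h3⟩
        · exact Or.inl hz
        · exact Or.inr ⟨e', h1, by omega, (hWlt e' h2).symm ▸ h3⟩
      · obtain ⟨z, hz, -⟩ := hz
        exact absurd hz (Set.notMem_empty z)
      · refine Or.inr ⟨e' + j, by omega, by omega, ?_⟩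
        rw [hWge _ (by omega), Fin.cons_le, Nat.add_sub_cancel]
        exact ⟨hv0.ge, h3⟩
  have hdeg : ∀ e, s ≤ e → e < n' + j → deg (W e) = e := by
    intro e h1 h2
    by_cases he : e < n
    · rw [hWlt e he, h.deg_eq e h1 he]
    · rw [hWge e (by omega), deg_cons, h'.deg_eq (e - j) (by omega) (by omega)]
      omega
  refine ⟨hdeg, ?_, ?_, ?_⟩
  · intro e h1 h2
    by_cases he : e < n
    · rw [hlow e he.le, hWlt e he]
      exact h.not_gen e h1 he
    · rw [hhigh e (by omega) _ (by rw [hdeg e h1 h2]; omega), hWge e (by omega)]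
      simp only [Fin.cons_zero, Fin.tail_cons]
      rintro (hc | ⟨-, hc⟩)
      · omega
      · exact h'.not_gen (e - j) (by omega) (by omega) hc
  · intro e h1 h2 u v hu hv hg hlt
    by_cases he : e < n
    · rw [hlow (e + 1) he] at hg ⊢
      exact h.seg e h1 he u v hu hv hg hlt
    · rw [hhigh (e + 1) (by omega) _ (by omega)] at hg ⊢
      rw [show e + 1 - j = e - j + 1 by omega] at hg ⊢
      rcases lex_tail hlt with h0 | ⟨h0, ht⟩
      · left
        omega
      · rw [h0]
        refine hg.imp id fun hg => ⟨hg.1, ?_⟩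
        have hud := deg_eq_add_tail u
        have hvd := deg_eq_add_tail v
        exact h'.seg (e - j) (by omega) (by omega) _ _ (by omega) (by omega) hg.2 ht
  · intro v hv
    rw [hhigh (n' + j) (by omega) v (by omega)]
    constructor
    · rintro (hc | ⟨hc, -⟩) <;> omega
    · intro hc
      rcases hc.eq_or_lt with hc | hc
      · right
        have hvd := deg_eq_add_tail v
        refine ⟨hc.symm, ?_⟩
        rw [Nat.add_sub_cancel]
        exact (h'.top _ (by omega)).2 (Nat.zero_le _)
      · exact Or.inl hc

/-- Lexicographic antichains which start with a pure power of the first variable. -/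
def HasRuns (m : ℕ) : Prop :=
  ∀ a, 1 ≤ a → ∃ w : ℕ → Fin (m + 1) → ℕ, LexStage ∅ a (ack (m + 1) (a - 1)) 0 w

/-- The parameter `y` is the end of the stage minus the current first entry. Lowering that entry by
one starts a run in degree `y + 1` in one variable fewer, and so replaces `y` by `ack (m + 1) y`. -/
theorem LexStage.iterate {m : ℕ} (hR : HasRuns m) {Z : Set (Fin (m + 2) → ℕ)} {s a y : ℕ}
    {w : ℕ → Fin (m + 2) → ℕ} (h : LexStage Z s (a + y) a w) (hs : s ≤ a + y) :
    ∀ i, i ≤ a → ∃ w', LexStage Z s ((a - i) + (ack (m + 1))^[i] y) (a - i) w' ∧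
      s ≤ (a - i) + (ack (m + 1))^[i] y := by
  intro i
  induction i with
  | zero => exact fun _ => ⟨w, h, hs⟩
  | succ i ih =>
    intro hi
    obtain ⟨w₁, h₁, hs₁⟩ := ih (by omega)
    rw [Function.iterate_succ_apply']
    set y' := (ack (m + 1))^[i] y
    have hlt : y' < ack (m + 1) y' := lt_ack_right (m + 1) y'
    obtain ⟨w₂, h₂⟩ := hR (y' + 1) (by omega)
    rw [Nat.add_sub_cancel] at h₂
    have h₁' : LexStage Z s (a - i + y') (a - (i + 1) + 1) w₁ := by
      rwa [show a - (i + 1) + 1 = a - i by omega]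
    have h₂' : LexStage ∅ (a - i + y' - (a - (i + 1))) (ack (m + 1) y') 0 w₂ := by
      rwa [show a - i + y' - (a - (i + 1)) = y' + 1 by omega]
    have h₃ := h₁'.extend hs₁ (by omega) h₂' (by omega)
    rw [Nat.add_comm (ack (m + 1) y')] at h₃
    exact ⟨_, h₃, by omega⟩

theorem lexStage_single {m : ℕ} (a : ℕ) :
    LexStage (∅ : Set (Fin (m + 1) → ℕ)) a (a + 1) a fun _ => Pi.single 0 a := by
  have hle : ∀ v : Fin (m + 1) → ℕ, Pi.single 0 a ≤ v ↔ a ≤ v 0 := by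
    intro v
    constructor
    · intro h
      simpa using h 0
    · intro h k
      by_cases hk : k = 0
      · subst hk; simpa using h
      · simp [Pi.single_eq_of_ne hk]
  have hg : ∀ n, a < n → ∀ v, Gen (∅ : Set (Fin (m + 1) → ℕ)) (fun _ => Pi.single 0 a) a n v ↔
      a ≤ v 0 := by
    intro n hn v
    constructor
    · rintro (⟨z, hz, -⟩ | ⟨e, -, -, h⟩)
      · exact absurd hz (Set.notMem_empty z)
      · exact (hle v).1 h
    · exact fun h => Or.inr ⟨a, le_rfl, hn, (hle v).2 h⟩
  refine ⟨fun e h1 h2 => ?_, fun e h1 h2 => ?_, fun e h1 h2 u v hu hv h3 h4 => ?_, fun v _ => ?_⟩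
  · rw [deg_single]
    omega
  · rintro (⟨z, hz, -⟩ | ⟨e', _, _, -⟩)
    · exact absurd hz (Set.notMem_empty z)
    · omega
  · rw [hg _ (by omega)] at h3 ⊢
    rcases lex_tail h4 with h | h <;> omega
  · exact hg _ (by omega) v

/-- In one variable a run is a single vector. With a further variable, the pure power of degree `a`
leaves `y = 1`, and `a` descents give `(ack (m + 1))^[a] 1 = ack (m + 2) (a - 1)`. -/
theorem hasRuns (m : ℕ) : HasRuns m := by
  induction m with
  | zero =>
    intro a ha
    have h := lexStage_single (m := 0) a
    rw [show ack (0 + 1) (a - 1) = a + 1 by simp; omega]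
    refine ⟨_, h.deg_eq, h.not_gen, h.seg, fun v hv => ?_⟩
    rw [h.top v hv]
    simp [deg] at hv ⊢
    omega
  | succ m ih =>
    intro a ha
    obtain ⟨w, hw, -⟩ := (lexStage_single a).iterate ih (by omega) a le_rfl
    refine ⟨w, ?_⟩
    rw [ack_succ_eq_iterate, Nat.sub_add_cancel ha]
    simpa using hw

/-- The extremal antichain: besides a pure power of degree `r` it has one member in each degree
from `r` on. -/
theorem exists_extremal_lexStage (m r : ℕ) :
    ∃ w : ℕ → Fin (m + 2) → ℕ, LexStage {Pi.single 0 r} r ((ack (m + 1))^[r] 0) 0 w := by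
  have h : LexStage {(Pi.single 0 r : Fin (m + 2) → ℕ)} r (r + 0) r fun _ => 0 := by
    refine ⟨fun e h1 h2 => by omega, fun e h1 h2 => by omega, fun e h1 h2 => by omega,
      fun v _ => ?_⟩
    constructor
    · rintro (⟨z, rfl, h⟩ | ⟨e, h1, h2, -⟩)
      · simpa using h 0
      · omega
    · refine fun h => Or.inl ⟨_, rfl, fun k => ?_⟩
      by_cases hk : k = 0
      · subst hk; simpa using h
      · simp [Pi.single_eq_of_ne hk]
  obtain ⟨w, hw, -⟩ := h.iterate (hasRuns m) (by omega) r le_rfl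
  exact ⟨w, by simpa using hw⟩

/-! ### Comparison with an extremal sequence of segments -/

theorem up_monos (m d : ℕ) : up (monos m d) = monos m (d + 1) := by
  ext v
  rw [(show Homog d (monos m d) from fun _ h => mem_monos.1 h).mem_up_iff, mem_monos]
  refine ⟨fun h => h.1, fun h => ⟨h, ?_⟩⟩
  obtain ⟨u, -, hu, hd⟩ := exists_between (u := 0) (v := v) (fun _ => Nat.zero_le _) (e := d)
    (by simp [deg]) (by omega)
  exact ⟨u, mem_monos.2 hd, hu⟩

/-- A sequence of sets which grows faster than a sequence of segments exhausting degree `n - 1`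
must stop before degree `n`. -/
theorem lt_of_growth {m s n Q : ℕ} {W I : ℕ → Finset (Fin (m + 1) → ℕ)} {c : ℕ → ℕ} (hsn : s < n)
    (hW : ∀ e, s ≤ e → e < n → IsSeg e (W e))
    (hWstep : ∀ e, s ≤ e → e + 1 < n → (W (e + 1)).card ≤ (up (W e)).card + 1)
    (hWtop : W (n - 1) = monos (m + 1) (n - 1)) (hI : ∀ e, Homog e (I e))
    (hIstep : ∀ e, s ≤ e → e + 1 ≤ Q → ∀ L : Finset (Fin (m + 1) → ℕ), IsSeg e L → L.card = (I e).card →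
      (up L).card + c (e + 1) ≤ (I (e + 1)).card)
    (hc : ∀ e, s ≤ e → e ≤ Q →
      (W s).card + (e - s) ≤ (I s).card + ∑ k ∈ Finset.Ico s e, c (k + 1)) : Q < n := by
  by_contra hnQ
  -- The surplus of `I e` over `W e` is at least the initial difference plus the sum of the `c`
  -- minus `e - s`, written without subtraction. By `hc` this bound is never negative, so it passes
  -- through shadows of segments.
  have key : ∀ e, s ≤ e → e < n → (W e).card + (I s).card + ∑ k ∈ Finset.Ico s e, c (k + 1) ≤
      (I e).card + (W s).card + (e - s) := by
    intro e hse
    induction e, hse using Nat.le_induction with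
    | base => intro _; simp; omega
    | succ e hse ih =>
      intro hen
      have h1 := ih (by omega)
      have h2 := hc e hse (by omega)
      rw [Finset.sum_Ico_succ_top hse]
      obtain ⟨L, hL, hcard⟩ := (hI e).exists_isSeg_card_eq
      have h3 := hIstep e hse (by omega) L hL hcard
      have h4 := (hW e hse (by omega)).card_up_add_le hL
        (c := (I s).card + ∑ k ∈ Finset.Ico s e, c (k + 1) - ((W s).card + (e - s))) (by omega)
      have h5 := hWstep e hse hen
      omega
  obtain ⟨N, rfl⟩ : ∃ N, n = N + 1 := ⟨n - 1, by omega⟩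
  rw [Nat.add_sub_cancel] at hWtop
  have h1 := key N (by omega) (by omega)
  -- In degree `N` everything is exhausted, so `I N` is full and the bound in `hc` is attained with
  -- equality. Then `c (N + 1)` must vanish, which violates `hc` at `N + 1`.
  have h2 := hc N (by omega) (by omega)
  have h3 := hc (N + 1) (by omega) (by omega)
  rw [Finset.sum_Ico_succ_top (by omega)] at h3
  have h4 := Finset.card_le_card (hI N).subset_monos
  have h5 := Finset.card_le_card (hI (N + 1)).subset_monos
  have h6 := hIstep N (by omega) (by omega) _ (isSeg_monos _ N) (by rw [hWtop] at h1; omega)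
  rw [up_monos] at h6
  rw [hWtop] at h1
  omega

open Classical in
/-- The multiples of degree `e` of the members of a stage. -/
noncomputable def stageMult {m : ℕ} (Z : Set (Fin m → ℕ)) (w : ℕ → Fin m → ℕ) (s e : ℕ) :
    Finset (Fin m → ℕ) := (monos m e).filter (Gen Z w s (e + 1))

theorem mem_stageMult {m s e : ℕ} {Z : Set (Fin m → ℕ)} {w : ℕ → Fin m → ℕ} {v : Fin m → ℕ} :
    v ∈ stageMult Z w s e ↔ deg v = e ∧ Gen Z w s (e + 1) v := by
  simp [stageMult]

namespace LexStage

variable {m s n : ℕ} {Z : Set (Fin (m + 1) → ℕ)} {w : ℕ → Fin (m + 1) → ℕ}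

theorem isSeg (h : LexStage Z s n 0 w) {e : ℕ} (h1 : s ≤ e) (h2 : e < n) :
    IsSeg e (stageMult Z w s e) := by
  refine ⟨fun u hu => (mem_stageMult.1 hu).1, fun u v hu hv hlt => mem_stageMult.2 ⟨hu, ?_⟩⟩
  rw [mem_stageMult] at hv
  exact h.seg e h1 h2 u v hu hv.1 hv.2 hlt

theorem stageMult_top (h : LexStage Z s n 0 w) (hn : 0 < n) :
    stageMult Z w s (n - 1) = monos (m + 1) (n - 1) := by
  ext v
  rw [mem_stageMult, mem_monos]
  refine ⟨fun h => h.1, fun hv => ⟨hv, ?_⟩⟩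
  rw [Nat.sub_add_cancel hn]
  exact (h.top v (by omega)).2 (Nat.zero_le _)

theorem card_stageMult_succ_le (h : LexStage Z s n 0 w) (hZ : ∀ z ∈ Z, deg z ≤ s) {e : ℕ}
    (h1 : s ≤ e) (h2 : e + 1 < n) :
    (stageMult Z w s (e + 1)).card ≤ (up (stageMult Z w s e)).card + 1 := by
  refine (Finset.card_le_card (t := insert (w (e + 1)) (up (stageMult Z w s e))) ?_).trans
    (Finset.card_insert_le _ _)
  intro v hv
  obtain ⟨hd, hg⟩ := mem_stageMult.1 hv
  have hmem : ∀ x ≤ v, deg x ≤ e → (∀ y, x ≤ y → Gen Z w s (e + 1) y) →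
      v ∈ up (stageMult Z w s e) := by
    intro x hx hxd hgen
    obtain ⟨y, hy1, hy2, hy3⟩ := exists_between hx hxd (by omega)
    exact ((h.isSeg h1 (by omega)).1).mem_up_iff.2
      ⟨hd, y, mem_stageMult.2 ⟨hy3, hgen y hy1⟩, hy2⟩
  rw [Finset.mem_insert]
  rcases hg with ⟨z, hz, hzv⟩ | ⟨e', he1, he2, hv'⟩
  · exact Or.inr (hmem z hzv ((hZ z hz).trans h1) fun y hy => Or.inl ⟨z, hz, hy⟩)
  · have hde := h.deg_eq e' he1 (by omega)
    rcases (Nat.lt_succ_iff.1 he2).eq_or_lt with rfl | hlt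
    · exact Or.inl (eq_of_le_of_deg_le hv' (by omega)).symm
    · exact Or.inr (hmem _ hv' (by omega) fun y hy => Or.inr ⟨e', he1, hlt, hy⟩)

end LexStage

/-! ### Antichain sequences in one component -/

section Sequences

variable {M k : ℕ} {α : Fin k → Idx M 1}

theorem IsAntichainSeq.eq_of_le (hα : IsAntichainSeq α) {a b : Fin k}
    (h : (α a).exp ≤ (α b).exp) : a = b := by
  by_contra hne
  exact hα a b hne ⟨Subsingleton.elim _ _, h⟩

theorem mem_gammaUpTo {p : ℕ} {η : Fin M → ℕ} {c : Fin 1} :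
    Idx.mk η c ∈ gammaUpTo α p ↔ deg η ≤ p ∧ ∃ a, (α a).exp = η := by
  constructor
  · rintro ⟨⟨a, ha⟩, hd⟩
    exact ⟨hd, a, by rw [ha]⟩
  · rintro ⟨hd, a, rfl⟩
    refine ⟨⟨a, ?_⟩, hd⟩
    have : (α a).comp = c := Subsingleton.elim _ _
    subst this
    rfl

open Classical in
/-- The vectors of degree `e` above a member of the sequence. -/
noncomputable def mult (α : Fin k → Idx M 1) (e : ℕ) : Finset (Fin M → ℕ) :=
  (monos M e).filter fun v => ∃ a, (α a).exp ≤ v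

theorem mem_mult {e : ℕ} {v : Fin M → ℕ} :
    v ∈ mult α e ↔ deg v = e ∧ ∃ a, (α a).exp ≤ v := by simp [mult]

theorem homog_mult (α : Fin k → Idx M 1) (e : ℕ) : Homog e (mult α e) :=
  fun _ h => (mem_mult.1 h).1

/-- The number of members of degree `e`. -/
def numDeg (α : Fin k → Idx M 1) (e : ℕ) : ℕ :=
  (Finset.univ.filter fun a => deg (α a).exp = e).card

/-- The number of members of degree at most `e`. -/
def numDegLe (α : Fin k → Idx M 1) (e : ℕ) : ℕ :=
  (Finset.univ.filter fun a => deg (α a).exp ≤ e).card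

theorem numDegLe_succ (α : Fin k → Idx M 1) (e : ℕ) :
    numDegLe α (e + 1) = numDegLe α e + numDeg α (e + 1) := by
  unfold numDegLe numDeg
  rw [← Finset.card_union_of_disjoint]
  · congr 1
    ext a
    simp
    omega
  · rw [Finset.disjoint_left]
    intro a
    simp
    omega

theorem numDegLe_eq_add_sum (α : Fin k → Idx M 1) {s e : ℕ} (h : s ≤ e) :
    numDegLe α e = numDegLe α s + ∑ j ∈ Finset.Ico s e, numDeg α (j + 1) := by
  induction e, h using Nat.le_induction with
  | base => simp
  | succ e h ih => rw [Finset.sum_Ico_succ_top h, numDegLe_succ, ih, add_assoc]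

theorem up_mult_subset (α : Fin k → Idx M 1) (e : ℕ) : up (mult α e) ⊆ mult α (e + 1) := by
  intro v hv
  obtain ⟨hd, u, hu, hle⟩ := (homog_mult α e).mem_up_iff.1 hv
  obtain ⟨-, a, ha⟩ := mem_mult.1 hu
  exact mem_mult.2 ⟨hd, a, ha.trans hle⟩

theorem IsAntichainSeq.exp_notMem_up (hα : IsAntichainSeq α) {a : Fin k} {e : ℕ} :
    (α a).exp ∉ up (mult α e) := by
  intro h
  obtain ⟨hd, u, hu, hle⟩ := (homog_mult α e).mem_up_iff.1 h
  obtain ⟨hd', b, hb⟩ := mem_mult.1 hu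
  have := hα.eq_of_le (hb.trans hle)
  subst this
  have := deg_mono hb
  omega

theorem IsAntichainSeq.card_image (hα : IsAntichainSeq α) (e : ℕ) :
    ((Finset.univ.filter fun a => deg (α a).exp = e).image fun a => (α a).exp).card =
      numDeg α e :=
  Finset.card_image_of_injective _ fun _ _ h => hα.eq_of_le (le_of_eq h)

/-- A member of degree `e + 1` lies above no other member, hence outside the shadow of the multiples
of degree `e`. -/
theorem IsAntichainSeq.card_up_add_le (hα : IsAntichainSeq α) (e : ℕ) :
    (up (mult α e)).card + numDeg α (e + 1) ≤ (mult α (e + 1)).card := by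
  rw [← hα.card_image, ← Finset.card_union_of_disjoint]
  · refine Finset.card_le_card (Finset.union_subset (up_mult_subset α e) fun v hv => ?_)
    obtain ⟨a, ha, rfl⟩ := Finset.mem_image.1 hv
    exact mem_mult.2 ⟨(Finset.mem_filter.1 ha).2, a, le_rfl⟩
  · rw [Finset.disjoint_right]
    intro v hv
    obtain ⟨a, -, rfl⟩ := Finset.mem_image.1 hv
    exact hα.exp_notMem_up

end Sequences

theorem card_le_card_up {m : ℕ} (A : Finset (Fin (m + 1) → ℕ)) : A.card ≤ (up A).card := by
  rw [← Finset.card_image_of_injective A (add_left_injective (Pi.single 0 1))]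
  refine Finset.card_le_card fun v hv => ?_
  obtain ⟨u, hu, rfl⟩ := Finset.mem_image.1 hv
  exact add_single_mem_up hu 0

theorem IsAntichainSeq.numDegLe_le {m k : ℕ} {α : Fin k → Idx (m + 1) 1}
    (hα : IsAntichainSeq α) (e : ℕ) : numDegLe α e ≤ (mult α e).card := by
  induction e with
  | zero =>
    have : numDegLe α 0 = numDeg α 0 := by simp [numDegLe, numDeg]
    rw [this, ← hα.card_image]
    refine Finset.card_le_card fun v hv => ?_
    obtain ⟨a, ha, rfl⟩ := Finset.mem_image.1 hv
    exact mem_mult.2 ⟨(Finset.mem_filter.1 ha).2, a, le_rfl⟩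
  | succ e ih =>
    rw [numDegLe_succ]
    exact (Nat.add_le_add_right (ih.trans (card_le_card_up _)) _).trans (hα.card_up_add_le e)

/-! ### The chain condition -/

theorem exists_seq_of_reflTransGen {β : Type*} {R : β → β → Prop} {a b : β}
    (h : Relation.ReflTransGen R a b) : ∃ (s : ℕ) (f : Fin (s + 1) → β),
      f 0 = a ∧ f (Fin.last s) = b ∧ ∀ l : Fin s, R (f l.castSucc) (f l.succ) := by
  induction h using Relation.ReflTransGen.head_induction_on with
  | refl => exact ⟨0, fun _ => b, rfl, rfl, fun l => l.elim0⟩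
  | @head a c hac _ ih =>
    obtain ⟨s, f, h0, hl, hf⟩ := ih
    refine ⟨s + 1, Fin.cons a f, rfl, by rw [← Fin.succ_last, Fin.cons_succ, hl], fun l => ?_⟩
    refine Fin.cases ?_ (fun l => ?_) l
    · simpa [h0] using hac
    · rw [← Fin.succ_castSucc, Fin.cons_succ, Fin.cons_succ]
      exact hf l

/-- If the number of multiples grows as slowly as possible from degree `d` to `d + 1`, then the
chain condition holds for `d + 1`. -/
theorem IsAntichainSeq.chainCondition {M k d : ℕ} (hM : 2 ≤ M) {α : Fin k → Idx M 1}
    (hα : IsAntichainSeq α) {L : Finset (Fin M → ℕ)} (hL : IsSeg d L)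
    (hcard : L.card = (mult α d).card) (hle : (mult α (d + 1)).card ≤ (up L).card) :
    ChainCondition α (d + 1) := by
  have hmac := macaulay_of_two_le hM d _ L (homog_mult α d) hL hcard.le
  have hup : up (mult α d) = mult α (d + 1) :=
    Finset.eq_of_subset_of_card_le (up_mult_subset α d) (hle.trans hmac)
  have hG : Gotz d (mult α d) := by
    refine ⟨homog_mult α d, fun L' hL' hc => ?_⟩
    rw [hup, hL'.eq_of_card_eq hL (hc.trans hcard.symm)]
    exact hle
  -- The multiples of degree `d + 1` are all in the shadow, so there is no member of degree `d + 1`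
  -- and all relevant members have multiples of degree `d`.
  have hdeg : ∀ a, deg (α a).exp ≤ d + 1 → deg (α a).exp ≤ d := by
    intro a ha
    by_contra hc
    exact hα.exp_notMem_up (e := d) (hup ▸ mem_mult.2 ⟨by omega, a, le_rfl⟩)
  rintro ⟨τ, c⟩ - hτ i j - ⟨⟨β₁, c₁⟩, hβ₁, hc₁, hi⟩ ⟨⟨β₂, c₂⟩, hβ₂, hc₂, hj⟩
  dsimp only at hτ hc₁ hc₂ hi hj ⊢
  subst hc₁ hc₂
  have hmult : ∀ β κ, Idx.mk β c₂ ∈ gammaUpTo α (d + 1) → LeSubUnit β τ κ →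
      ∃ u, β ≤ u ∧ u ≤ τ ∧ u ∈ mult α d := by
    intro β κ hβ hκ
    obtain ⟨hd, a, rfl⟩ := mem_gammaUpTo.1 hβ
    obtain ⟨u, h1, h2, h3⟩ := exists_between (u := (α a).exp) (v := τ) (e := d)
      (le_trans (by simp) hκ) (hdeg a hd) (by omega)
    exact ⟨u, h1, h2, mem_mult.2 ⟨h3, a, h1⟩⟩
  obtain ⟨u, hu1, hu2, hu3⟩ := hmult β₁ i hβ₁ hi
  obtain ⟨v, hv1, hv2, hv3⟩ := hmult β₂ j hβ₂ hj
  let V : (Fin M → ℕ) × Fin M → Prop := fun x =>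
    Idx.mk x.1 c₂ ∈ gammaUpTo α (d + 1) ∧ LeSubUnit x.1 τ x.2
  let R : (Fin M → ℕ) × Fin M → (Fin M → ℕ) × Fin M → Prop := fun x y =>
    V y ∧ deg (x.1 ⊔ y.1) ≤ d + 1
  -- The path between multiples of degree `d` is pushed down to members below them, which only
  -- lowers least upper bounds. An index `κ` exists at each intermediate member because its degree
  -- is less than that of `τ`.
  have key : ∀ x, Joined d (mult α d) τ u x → ∀ y, V y → y.1 ≤ x →
      Relation.ReflTransGen R (β₁, i) y := by
    intro x hx
    induction hx with
    | refl =>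
      intro y hy hyu
      refine Relation.ReflTransGen.single ⟨hy, ?_⟩
      have := deg_mono (sup_le hu1 hyu)
      rw [homog_mult α d u hu3] at this
      exact this.trans (Nat.le_succ d)
    | @tail x z _ hstep ih =>
      intro y hy hyz
      obtain ⟨hxm, hxτ, -, -, hd⟩ := hstep
      obtain ⟨hxd, a, ha⟩ := mem_mult.1 hxm
      have had := deg_mono ha
      obtain ⟨κ, hκ⟩ := exists_lt_of_deg_lt (u := (α a).exp) (v := τ) (by omega)
      refine (ih ((α a).exp, κ) ⟨mem_gammaUpTo.2 ⟨by dsimp only; omega, a, rfl⟩,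
        add_single_le (ha.trans hxτ) hκ⟩ ha).tail ⟨hy, ?_⟩
      exact (deg_mono (sup_le_sup ha hyz)).trans hd
  obtain ⟨s, f, h0, hl, hf⟩ := exists_seq_of_reflTransGen
    (key v (hG.joined hM τ u hu3 v hv3 hu2 hv2) (β₂, j) ⟨hβ₂, hj⟩ hv1)
  have hV : ∀ l, V (f l) := fun l =>
    Fin.cases (by rw [h0]; exact ⟨hβ₁, hi⟩) (fun l => (hf l).1) l
  exact ⟨s, fun l => (f l).1, fun l => (f l).2, fun l => (hV l).1, fun l => (hV l).2,
    by simp only [h0], by simp only [hl], fun l => (hf l).2⟩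

/-- A member `x + e_k` of degree `p` obstructs the chain condition for `p` if a vector `x + e_i`
with `i < k` lies above a member of degree at most `p`. -/
theorem IsAntichainSeq.not_chainCondition {M k p : ℕ} {α : Fin k → Idx M 1}
    (hα : IsAntichainSeq α) {a b : Fin k} {x : Fin M → ℕ} {i t : Fin M} (hit : i < t)
    (ha : (α a).exp = x + Pi.single t 1) (hda : deg (α a).exp = p) (hdb : deg (α b).exp ≤ p)
    (hb : (α b).exp ≤ x + Pi.single i 1) : ¬ ChainCondition α p := by
  intro hC
  set w := (α a).exp with hw
  have hwx : w ≠ x := fun h => by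
    have := congrFun ha t
    rw [h] at this
    simp at this
  have hxw : x ≤ w := by rw [ha]; simp
  have hwi : w i = x i := by rw [ha]; simp [Pi.single_eq_of_ne hit.ne]
  have hbi : x i < (α b).exp i := by
    by_contra hc
    have hbx : (α b).exp ≤ x := by
      intro l
      by_cases hl : l = i
      · subst hl; exact not_lt.1 hc
      · simpa [Pi.single_eq_of_ne hl] using hb l
    have hab := hα.eq_of_le (hbx.trans hxw)
    subst hab
    exact hwx (le_antisymm hbx hxw)
  have hsup : w + Pi.single i 1 = w ⊔ (α b).exp := by
    refine le_antisymm (add_single_le le_sup_left ?_) (sup_le (by simp) (hb.trans ?_))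
    · simp only [Pi.sup_apply]
      omega
    · exact add_le_add_left hxw _
  have hne : w ≠ (α b).exp := fun h => by rw [← h] at hbi; omega
  have hgam : ∀ η, Idx.mk η (0 : Fin 1) ∈ gammaUpTo α p → η ≤ w → η = w := by
    intro η hη hle
    obtain ⟨-, c, rfl⟩ := mem_gammaUpTo.1 hη
    rw [hα.eq_of_le hle]
  obtain ⟨s, η, κ, h1, h2, h3, h4, h5⟩ := hC ⟨w + Pi.single i 1, 0⟩
    ⟨w, (α b).exp, hne, mem_gammaUpTo.2 ⟨hda.le, a, rfl⟩, mem_gammaUpTo.2 ⟨hdb, b, rfl⟩, hsup⟩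
    (by dsimp only; rw [deg_add_single]; omega) i t hit
    ⟨⟨w, 0⟩, mem_gammaUpTo.2 ⟨hda.le, a, rfl⟩, rfl, le_rfl⟩
    ⟨⟨(α b).exp, 0⟩, mem_gammaUpTo.2 ⟨hdb, b, rfl⟩, rfl, by
      change (α b).exp + Pi.single t 1 ≤ w + Pi.single i 1
      rw [ha, add_right_comm]
      exact add_le_add_left hb _⟩
  -- Since `deg w = p`, a least upper bound with `w` of degree at most `p` is `w` itself; by
  -- incomparability the chain never leaves `w`. But `w` is not below `τ - e_t` for `τ = w + e_i`.
  have hall : ∀ l, η l = w := by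
    intro l
    induction l using Fin.induction with
    | zero =>
      refine hgam _ (h1 0) ?_
      have := h2 0
      rw [h3] at this
      exact le_of_add_le_add_right this
    | succ l ih =>
      refine hgam _ (h1 _) ?_
      have := h5 l
      rw [ih] at this
      have h6 := eq_of_le_of_deg_le (u := w) (v := w ⊔ η l.succ) le_sup_left (by omega)
      rw [h6]
      exact le_sup_right
  have h6 := h2 (Fin.last s)
  rw [h4, hall] at h6
  have h7 : (w + Pi.single t 1 : Fin M → ℕ) t ≤ (w + Pi.single i 1 : Fin M → ℕ) t := h6 t
  simp [Pi.single_eq_of_ne hit.ne'] at h7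

/-! ### The extremal values in at least two variables -/

section Extremal

variable {m r : ℕ} {w : ℕ → Fin (m + 2) → ℕ}

theorem lt_iterate_ack (m : ℕ) (hr : 1 ≤ r) : r < (ack (m + 1))^[r] 0 := by
  induction r, hr using Nat.le_induction with
  | base => simpa using add_lt_ack (m + 1) 0 |>.trans_le' (by omega)
  | succ r _ ih =>
    rw [Function.iterate_succ_apply']
    exact lt_of_le_of_lt ih (lt_ack_right _ _)

theorem card_stageMult_start {n : ℕ} (h : LexStage {Pi.single 0 r} r n 0 w)
    (hlt : r < n) : (stageMult {Pi.single 0 r} w r r).card = 2 := by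
  have hd := h.deg_eq r le_rfl hlt
  have : stageMult {Pi.single 0 r} w r r = {Pi.single 0 r, w r} := by
    ext v
    rw [mem_stageMult]
    simp only [Gen, Set.mem_singleton_iff, exists_eq_left, Finset.mem_insert,
      Finset.mem_singleton]
    constructor
    · rintro ⟨hv, hz | ⟨e, h1, h2, hle⟩⟩
      · exact Or.inl (eq_of_le_of_deg_le hz (by rw [deg_single, hv])).symm
      · obtain rfl : e = r := by omega
        exact Or.inr (eq_of_le_of_deg_le hle (by rw [hd, hv])).symm
    · rintro (rfl | rfl)
      · exact ⟨deg_single _ _, Or.inl le_rfl⟩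
      · exact ⟨hd, Or.inr ⟨r, le_rfl, Nat.lt_succ_self r, le_rfl⟩⟩
  rw [this, Finset.card_pair]
  intro he
  exact h.not_gen r le_rfl hlt (Or.inl ⟨_, rfl, he.le⟩)

/-- The constant `2` counts the multiples of degree `r` in the extremal stage: the pure power and `w
r`. -/
theorem LexStage.lt_of_mult_growth {n : ℕ} (hw : LexStage {Pi.single 0 r} r n 0 w) (hlt : r < n)
    {k Q : ℕ} (α : Fin k → Idx (m + 2) 1) (c : ℕ → ℕ)
    (hstep : ∀ e, r ≤ e → e + 1 ≤ Q → ∀ L : Finset (Fin (m + 2) → ℕ), IsSeg e L →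
      L.card = (mult α e).card → (up L).card + c (e + 1) ≤ (mult α (e + 1)).card)
    (hc : ∀ e, r ≤ e → e ≤ Q →
      2 + (e - r) ≤ (mult α r).card + ∑ j ∈ Finset.Ico r e, c (j + 1)) : Q < n := by
  have hZ : ∀ z ∈ ({Pi.single 0 r} : Set (Fin (m + 2) → ℕ)), deg z ≤ r := by
    intro z hz
    rw [Set.mem_singleton_iff.1 hz, deg_single]
  have hc' : ∀ e, r ≤ e → e ≤ Q → (stageMult {Pi.single 0 r} w r r).card + (e - r) ≤
      (mult α r).card + ∑ j ∈ Finset.Ico r e, c (j + 1) := by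
    intro e h1 h2
    rw [card_stageMult_start hw hlt]
    exact hc e h1 h2
  exact lt_of_growth hlt (fun e h1 h2 => hw.isSeg (e := e) h1 h2)
    (fun e h1 h2 => hw.card_stageMult_succ_le hZ (e := e) h1 h2)
    (hw.stageMult_top (by omega)) (homog_mult α) hstep hc'

/-- The growth of the multiples of an antichain sequence is bounded by the extremal one. -/
theorem lt_of_mult_growth (hr : 1 ≤ r) {k Q : ℕ} (α : Fin k → Idx (m + 2) 1) (c : ℕ → ℕ)
    (hstep : ∀ e, r ≤ e → e + 1 ≤ Q → ∀ L : Finset (Fin (m + 2) → ℕ), IsSeg e L →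
      L.card = (mult α e).card → (up L).card + c (e + 1) ≤ (mult α (e + 1)).card)
    (hc : ∀ e, r ≤ e → e ≤ Q →
      2 + (e - r) ≤ (mult α r).card + ∑ j ∈ Finset.Ico r e, c (j + 1)) :
    Q < (ack (m + 1))^[r] 0 := by
  obtain ⟨w, hw⟩ := exists_extremal_lexStage m r
  exact hw.lt_of_mult_growth (lt_iterate_ack m hr) α c hstep hc

theorem length_add_le (hr : 1 ≤ r) {k : ℕ} {α : Fin k → Idx (m + 2) 1} (hα : IsAntichainSeq α)
    (hg : BoundsDegreeGrowth (g r) α) : k + r ≤ (ack (m + 1))^[r] 0 + 1 := by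
  have hlt := lt_iterate_ack m hr
  by_cases hk : k ≤ 1
  · omega
  have hmac := macaulay_of_two_le (m := m + 2) (by omega)
  -- Since `g` takes the value `r` at both `1` and `2` and then grows by one, the first `2 + (e -
  -- r)` members have degree at most `e`.
  have hnum : ∀ e, r ≤ e → e ≤ k + r - 2 → 2 + (e - r) ≤ numDegLe α e := by
    intro e h1 h2
    have hle : 2 + (e - r) ≤ k := by omega
    have : (Finset.univ.map (Fin.castLEEmb hle)).card ≤ numDegLe α e := by
      refine Finset.card_le_card fun a ha => ?_
      obtain ⟨b, -, rfl⟩ := Finset.mem_map.1 ha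
      rw [Finset.mem_filter]
      refine ⟨Finset.mem_univ _, (hg _).trans ?_⟩
      have := b.isLt
      simp only [g, Fin.castLEEmb_apply, Fin.val_castLE]
      split_ifs <;> omega
    simpa using this
  have := lt_of_mult_growth (Q := k + r - 2) hr α (numDeg α) (fun e _ _ L hL hcard =>
      (Nat.add_le_add_right (hmac _ _ L (homog_mult α e) hL hcard.le) _).trans
        (hα.card_up_add_le e))
    (fun e h1 h2 => (hnum e h1 h2).trans (by
      rw [numDegLe_eq_add_sum α h1]
      exact Nat.add_le_add_right (hα.numDegLe_le r) _))
  omega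

theorem two_le_numDegLe_of_not_chainCondition {M k p : ℕ} {α : Fin k → Idx M 1}
    (h : ¬ ChainCondition α p) : 2 ≤ numDegLe α p := by
  by_contra hc
  refine h fun τ hτ => ?_
  obtain ⟨η, ζ, hne, hη, hζ, -⟩ := hτ
  obtain ⟨h1, a, rfl⟩ := mem_gammaUpTo.1 hη
  obtain ⟨h2, b, rfl⟩ := mem_gammaUpTo.1 hζ
  have hab : a ≠ b := fun h => hne (by rw [h])
  have hsub : ({a, b} : Finset (Fin k)) ⊆
      Finset.univ.filter fun a => deg (α a).exp ≤ p := by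
    intro x hx
    rw [Finset.mem_insert, Finset.mem_singleton] at hx
    rcases hx with rfl | rfl <;> simpa
  have := Finset.card_le_card hsub
  rw [Finset.card_pair hab] at this
  exact absurd this hc

/-- Every failure of the chain condition in a degree from `r + 1` to `D - 1` gives an excess of one
over Macaulay's minimum, and the failure in degree `r` gives the two initial multiples. So the
comparison applies with constant excess `1`. -/
theorem D_le (hr : 1 ≤ r) {k : ℕ} {α : Fin k → Idx (m + 2) 1} (hα : IsAntichainSeq α) :
    D r α ≤ (ack (m + 1))^[r] 0 := by
  have hlt := lt_iterate_ack m hr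
  by_contra hcon
  have hfail : ∀ p, r ≤ p → p < D r α → ¬ ChainCondition α p := fun p h1 h2 h3 =>
    absurd ((D_isLeast r α).2 ⟨h1, h3⟩) (by omega)
  have := lt_of_mult_growth (Q := D r α - 1) hr α (fun _ => 1) (fun e h1 h2 L hL hcard => by
      by_contra hc
      exact hfail (e + 1) (by omega) (by omega)
        (hα.chainCondition (by omega) hL hcard (by omega)))
    (fun e h1 h2 => by
      have := (two_le_numDegLe_of_not_chainCondition (hfail r le_rfl (by omega))).trans
        (hα.numDegLe_le r)
      simp
      omega)
  omega

/-- The extremal sequence, with the pure power of the first variable at the beginning. -/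
def extremalSeq (r : ℕ) (w : ℕ → Fin (m + 2) → ℕ) (k : ℕ) (a : Fin k) : Idx (m + 2) 1 :=
  ⟨if (a : ℕ) = 0 then Pi.single 0 r else w (r + a - 1), 0⟩

theorem isAntichainSeq_extremalSeq
    (h : LexStage {Pi.single 0 r} r ((ack (m + 1))^[r] 0) 0 w) {k : ℕ}
    (hk : k + r ≤ (ack (m + 1))^[r] 0 + 1) : IsAntichainSeq (extremalSeq r w k) := by
  rintro ⟨a, ha⟩ ⟨b, hb⟩ hab ⟨-, hle⟩
  have hab' : a ≠ b := fun h => hab (Fin.ext h)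
  simp only [extremalSeq] at hle
  have hd : ∀ e, r ≤ e → e < (ack (m + 1))^[r] 0 → deg (w e) = e := h.deg_eq
  split_ifs at hle with h1 h2 h2
  · omega
  · exact h.not_gen (r + b - 1) (by omega) (by omega) (Or.inl ⟨_, rfl, hle⟩)
  · have h3 := deg_mono hle
    rw [hd _ (by omega) (by omega), deg_single] at h3
    have h4 : r + a - 1 = r := by omega
    rw [h4] at hle
    have h5 := eq_of_le_of_deg_le hle (by rw [deg_single, hd r le_rfl (by omega)])
    exact h.not_gen r le_rfl (by omega) (Or.inl ⟨_, rfl, h5.ge⟩)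
  · have h3 := deg_mono hle
    rw [hd _ (by omega) (by omega), hd _ (by omega) (by omega)] at h3
    exact h.not_gen (r + b - 1) (by omega) (by omega)
      (Or.inr ⟨r + a - 1, by omega, by omega, hle⟩)

theorem boundsDegreeGrowth_extremalSeq
    (h : LexStage {Pi.single 0 r} r ((ack (m + 1))^[r] 0) 0 w) {k : ℕ}
    (hk : k + r ≤ (ack (m + 1))^[r] 0 + 1) : BoundsDegreeGrowth (g r) (extremalSeq r w k) := by
  rintro ⟨a, ha⟩
  simp only [extremalSeq, g]
  split_ifs with h1 h2 h2
  · simp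
  · omega
  · omega
  · rw [h.deg_eq _ (by omega) (by omega)]
    omega

/-- For `r ≤ p < F`, the member `w p` has degree at least `r` and is no multiple of `x_0^r`, so it
involves another variable `x_t`. Replacing `x_t` by `x_0` gives a lexicographically larger vector,
which by the segment property lies above a member of degree at most `p`; hence `not_chainCondition`
applies. -/
theorem le_D_extremalSeq (hr : 1 ≤ r)
    (h : LexStage {Pi.single 0 r} r ((ack (m + 1))^[r] 0) 0 w) {k : ℕ}
    (hk : k + r = (ack (m + 1))^[r] 0 + 1) :
    (ack (m + 1))^[r] 0 ≤ D r (extremalSeq r w k) := by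
  have hlt := lt_iterate_ack m hr
  have hanti := isAntichainSeq_extremalSeq h hk.le
  obtain ⟨hrD, hC⟩ := (D_isLeast r (extremalSeq r w k)).1
  by_contra hcon
  set p := D r (extremalSeq r w k)
  have hpF : p < (ack (m + 1))^[r] 0 := not_le.1 hcon
  have hd := h.deg_eq p hrD hpF
  have hexp : ∀ e, r ≤ e → e < (ack (m + 1))^[r] 0 →
      ∃ a : Fin k, (extremalSeq r w k a).exp = w e := by
    intro e h1 h2
    refine ⟨⟨e - r + 1, by omega⟩, ?_⟩
    simp only [extremalSeq]
    rw [if_neg (by omega)]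
    congr 1
    omega
  have hnot : ¬ (Pi.single 0 r ≤ w p) := fun hle =>
    h.not_gen p hrD hpF (Or.inl ⟨_, rfl, hle⟩)
  obtain ⟨t, ht0, ht⟩ : ∃ t, t ≠ 0 ∧ 0 < w p t := by
    by_contra hc
    push Not at hc
    refine hnot fun l => ?_
    by_cases hl : l = 0
    · subst hl
      have h1 : deg (w p) = w p 0 := Finset.sum_eq_single 0
        (fun b _ hb => Nat.le_zero.1 (hc b hb)) (fun h => absurd (Finset.mem_univ _) h)
      simp
      omega
    · simp [Pi.single_eq_of_ne hl]
  obtain ⟨x, hx⟩ := exists_eq_add_single ht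
  have ht0' : 0 < t := Fin.pos_of_ne_zero ht0
  obtain ⟨a, ha⟩ := hexp p hrD hpF
  have hgen : Gen {Pi.single 0 r} w r (p + 1) (x + Pi.single 0 1) := by
    refine h.seg p hrD hpF _ (w p) ?_ hd (Or.inr ⟨p, hrD, Nat.lt_succ_self p, le_rfl⟩) ?_
    · rw [deg_add_single]
      rw [hx, deg_add_single] at hd
      exact hd
    · rw [hx]
      exact lex_move x ht0'
  have hb : ∃ b, deg (extremalSeq r w k b).exp ≤ p ∧
      (extremalSeq r w k b).exp ≤ x + Pi.single 0 1 := by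
    rcases hgen with ⟨z, rfl, hz⟩ | ⟨e, h1, h2, hle⟩
    · exact ⟨⟨0, by omega⟩, by simpa [extremalSeq] using hrD, by simpa [extremalSeq] using hz⟩
    · obtain ⟨b, hb⟩ := hexp e h1 (by omega)
      exact ⟨b, by rw [hb, h.deg_eq e h1 (by omega)]; omega, hb ▸ hle⟩
  obtain ⟨b, hb1, hb2⟩ := hb
  exact hanti.not_chainCondition (a := a) ht0' (ha.trans hx) (ha ▸ hd) hb1 hb2 hC

end Extremal

/-! ### The extremal values in general -/

theorem isGreatest_values_of_two_le (m : ℕ) {r : ℕ} (hr : 1 ≤ r) :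
    IsGreatest (antichainLengths (g r) (m + 2) 1) ((ack (m + 1))^[r] 0 + 1 - r) ∧
      IsGreatest (DValues r (m + 2) 1) ((ack (m + 1))^[r] 0) := by
  have hlt := lt_iterate_ack m hr
  obtain ⟨w, hw⟩ := exists_extremal_lexStage m r
  have hk : (ack (m + 1))^[r] 0 + 1 - r + r = (ack (m + 1))^[r] 0 + 1 := by omega
  have hanti := isAntichainSeq_extremalSeq hw hk.le
  refine ⟨⟨⟨_, hanti, boundsDegreeGrowth_extremalSeq hw hk.le⟩, ?_⟩, ⟨⟨_, _, hanti, ?_⟩, ?_⟩⟩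
  · rintro k ⟨α, hα, hg⟩
    have := length_add_le hr hα hg
    omega
  · exact (le_D_extremalSeq hr hw hk).antisymm (D_le hr hanti)
  · rintro d ⟨k, α, hα, rfl⟩
    exact D_le hr hα

/-- If an antichain sequence has at most one member of degree at most `r`, then both extremal
values are trivial. -/
theorem isGreatest_values_of_unique {m r : ℕ} (hm : 1 ≤ m)
    (h : ∀ (u v : Fin m → ℕ), deg u ≤ r → deg v ≤ r → u ≤ v ∨ v ≤ u) :
    IsGreatest (antichainLengths (g r) m 1) 1 ∧ IsGreatest (DValues r m 1) r := by
  have huniq : ∀ (k : ℕ) (α : Fin k → Idx m 1), IsAntichainSeq α → ∀ a b,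
      deg (α a).exp ≤ r → deg (α b).exp ≤ r → a = b := by
    intro k α hα a b ha hb
    rcases h _ _ ha hb with hle | hle
    · exact hα.eq_of_le hle
    · exact (hα.eq_of_le hle).symm
  have hD : ∀ (k : ℕ) (α : Fin k → Idx m 1), IsAntichainSeq α → D r α = r := by
    intro k α hα
    refine le_antisymm ((D_isLeast r α).2 ⟨le_rfl, ?_⟩) (D_isLeast r α).1.1
    by_contra hc
    have h2 := two_le_numDegLe_of_not_chainCondition hc
    obtain ⟨a, ha, b, hb, hab⟩ := Finset.one_lt_card.1 (Nat.lt_of_succ_le h2)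
    exact hab (huniq k α hα a b (by simpa using ha) (by simpa using hb))
  refine ⟨⟨⟨fun _ => ⟨Pi.single ⟨0, hm⟩ r, 0⟩, fun i j hij => absurd (Subsingleton.elim i j) hij,
    fun i => ?_⟩, ?_⟩, ⟨⟨0, Fin.elim0, fun i => i.elim0, ?_⟩, ?_⟩⟩
  · simp [g]
  · rintro k ⟨α, hα, hg⟩
    by_contra hk
    have h0 := hg ⟨0, by omega⟩
    have h1 := hg ⟨1, by omega⟩
    simp only [g] at h0 h1
    have := huniq k α hα ⟨0, by omega⟩ ⟨1, by omega⟩ (by simpa using h0)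
      (h1.trans (by split_ifs <;> omega))
    simp at this
  · exact (hD 0 _ fun i => i.elim0).symm
  · rintro d ⟨k, α, hα, rfl⟩
    exact (hD k α hα).le

theorem iterate_ack_zero (r : ℕ) : (ack 0)^[r] 0 = r := by
  induction r with
  | zero => rfl
  | succ r ih => rw [Function.iterate_succ_apply', ih, ack_zero]

/-- The extremal length and the extremal value of `D`, in terms of the Ackermann function. -/
theorem isGreatest_values {m : ℕ} (hm : 1 ≤ m) (r : ℕ) :
    IsGreatest (antichainLengths (g r) m 1) ((ack (m - 1))^[r] 0 + 1 - r) ∧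
      IsGreatest (DValues r m 1) ((ack (m - 1))^[r] 0) ∧ r ≤ (ack (m - 1))^[r] 0 := by
  rcases hm.eq_or_lt with rfl | hm2
  · have := isGreatest_values_of_unique (m := 1) (r := r) le_rfl fun u v _ _ => by
      rcases le_total (u 0) (v 0) with h | h
      · exact Or.inl fun i => by rwa [Subsingleton.elim i 0]
      · exact Or.inr fun i => by rwa [Subsingleton.elim i 0]
    rw [Nat.sub_self, iterate_ack_zero, Nat.add_sub_cancel_left]
    exact ⟨this.1, this.2, le_rfl⟩
  · rcases Nat.eq_zero_or_pos r with rfl | hr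
    · have := isGreatest_values_of_unique (m := m) (r := 0) hm fun u v hu _ => Or.inl fun i => by
        have h1 : u i ≤ deg u := Finset.single_le_sum (fun _ _ => Nat.zero_le _)
          (Finset.mem_univ i)
        exact (h1.trans hu).trans (Nat.zero_le _)
      exact ⟨this.1, this.2, le_rfl⟩
    · obtain ⟨m, rfl⟩ : ∃ k, m = k + 2 := ⟨m - 2, by omega⟩
      obtain ⟨h1, h2⟩ := isGreatest_values_of_two_le m hr
      exact ⟨h1, h2, (lt_iterate_ack m hr).le⟩

theorem C_eq {m : ℕ} (hm : 1 ≤ m) (r : ℕ) : C r m 1 = (ack (m - 1))^[r] 0 :=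
  (isGreatest_values hm r).2.1.csSup_eq

theorem maxLength_eq {m : ℕ} (hm : 1 ≤ m) (r : ℕ) :
    maxLength (g r) m 1 = (ack (m - 1))^[r] 0 + 1 - r :=
  (isGreatest_values hm r).1.csSup_eq

end DiffKernel

open DiffKernel in
theorem theorem5p4 (m : ℕ) (hm : 1 ≤ m) (r : ℕ) :
    IsGreatest (DiffKernel.antichainLengths (DiffKernel.g r) m 1)
      (DiffKernel.maxLength (DiffKernel.g r) m 1) ∧
    IsGreatest (DiffKernel.DValues r m 1) (DiffKernel.C r m 1) ∧
    (DiffKernel.C r m 1 : ℤ) = (DiffKernel.maxLength (DiffKernel.g r) m 1 : ℤ) + (r : ℤ) - 1 ∧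
    (1 ≤ r →
      DiffKernel.C r m 1 = ack (m - 1) (DiffKernel.C (r - 1) m 1) ∧
      DiffKernel.C r m 1 ≤ ack m (r - 1) - 1) ∧
    (2 ≤ r → ack m (r - 2) ≤ DiffKernel.C r m 1) := by
  obtain ⟨h1, h2, h3⟩ := isGreatest_values hm r
  rw [C_eq hm, C_eq hm, maxLength_eq hm]
  obtain ⟨k, rfl⟩ : ∃ k, m = k + 1 := ⟨m - 1, by omega⟩
  rw [Nat.add_sub_cancel] at h1 h2 h3 ⊢
  have hmono := ack_strictMono_right k
  refine ⟨h1, h2, by omega, fun hr => ⟨?_, ?_⟩, fun hr => ?_⟩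
  · obtain ⟨r, rfl⟩ : ∃ s, r = s + 1 := ⟨r - 1, by omega⟩
    rw [Function.iterate_succ_apply', Nat.add_sub_cancel]
  -- With `f = ack k`, this is `f^[r] 0 < f^[r] 1`.
  · rw [ack_succ_eq_iterate, Nat.sub_add_cancel hr]
    exact Nat.le_sub_one_of_lt (hmono.iterate r Nat.zero_lt_one)
  -- One application of `f` is spent on `f 0 ≥ 1`; the remaining iterates are compared by
  -- monotonicity.
  · obtain ⟨r, rfl⟩ : ∃ s, r = s + 2 := ⟨r - 2, by omega⟩
    rw [ack_succ_eq_iterate, Nat.add_sub_cancel, Function.iterate_succ_apply]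
    exact (hmono.iterate (r + 1)).monotone (ack_pos k 0)
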